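/- Let $\mathscr I(x)=\tfrac12\big((1+x)\ln(1+x)+(1-x)\ln(1-x)\big)$ and, for $\alpha\in[0,1]$, real $J_{11},J_{12},J_{22},h_1,h_2$ and $\beta>0$, put $$f(\mu_1,\mu_2)=\beta\, g(\mu_1,\mu_2)-\alpha\,\mathscr I(\mu_1)-(1-\alpha)\,\mathscr I(\mu_2),\qquad (\mu_1,\mu_2)\in[-1,1]^2,$$ $$g(\mu_1,\mu_2)=\tfrac12\big(\alpha^2J_{11}\mu_1^2+2\alpha(1-\alpha)J_{12}\mu_1\mu_2+(1-\alpha)^2J_{22}\mu_2^2\big)+\alpha h_1\mu_1+(1-\alpha)h_2\mu_2 .$$ Assume $\alpha=1/2$, $J_{11}=J_{22}$, $h_1=h_2=0$, and let $\lambda_M$ and $\lambda_m$ be the larger and the smaller eigenvalue of the reduced matrix $\mathbf J=\begin{pmatrix}J_{11}&J_{12}\\J_{12}&J_{22}\end{pmatrix}$. Critical points are points of $(-1,1)^2$ where the differential of $f$ vanishes; maximum and minimum points are local ones; an inflection point is a critical point that is neither a local maximum nor a local minimum. Below, $\tilde x>0$ is a solution of $\tilde x=\tanh(\beta\lambda_M\tilde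 x/2)$ and $\hat x>0$ is a solution of $\hat x=\tanh(\beta\lambda_m\hat x/2)$ (these solutions exist wherever they are mentioned). 1. If $J_{11}>0$ and $J_{12}<0$, then $\lambda_M=J_{11}-J_{12}$, $\lambda_m=J_{11}+J_{12}$, and: (a) if $0<\beta\le 2/\lambda_M$, the origin is the unique critical point, and it is a maximum point; (b) if $\lambda_m<0$ and $\beta>2/\lambda_M$, or $\lambda_m>0$ and $2/\lambda_M<\beta<2/\lambda_m$, there are exactly three critical points, $(0,0)$ and $\pm(\tilde x,-\tilde x)$; the origin is an inflection point and the other two are maximum points. If $\lambda_m>0$, the equation $$\frac{\check\beta\tanh^{-1}\big(\sqrt{1-\check\beta}\big)}{\sqrt{1-\check\beta}}=\frac{\lambda_m}{\lambda_M}$$ has a unique solution $\check\beta\in(0,1)$, it satisfies $2/\lambda_m<2/(\check\beta\lambda_M)$, and: (c) if $2/\lambda_m<\beta<2/(\check\beta\lambda_M)$, there are exactly five critical points, $(0,0)$, $\pm(\tilde x,-\tilde x)$ and $\pm(\hat x,\hat x)$; the origin is a minimum point, $\pm(\tilde x,-\tilde x)$ are maximum points and $\pm(\hat x,\hat x)$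 are inflection points; (d) if $\beta>2/(\check\beta\lambda_M)$, there are exactly nine critical points, $(0,0)$, $\pm(\tilde x,-\tilde x)$, $\pm(\hat x,\hat x)$, $\pm(x_1^*,x_2^*)$ and $\pm(x_2^*,x_1^*)$ for some $0<x_1^*<x_2^*$; the origin is a minimum point, $\pm(\tilde x,-\tilde x)$ and $\pm(\hat x,\hat x)$ are maximum points, and the other four are not maximum points. 2. If $J_{11}<0$ and $J_{12}>|J_{11}|$, then $\lambda_M=J_{11}+J_{12}>0$, $\lambda_m=J_{11}-J_{12}<0$, and: (a) if $0<\beta<2/\lambda_M$, the origin is the unique critical point, and it is a maximum point; (b) if $\beta>2/\lambda_M$, there are exactly three critical points, $(0,0)$ and $\pm(\tilde x,\tilde x)$; the origin is an inflection point and $\pm(\tilde x,\tilde x)$ are maximum points. 3. If $J_{11}<0$ and $0<J_{12}<|J_{11}|$, then $\lambda_M=J_{11}+J_{12}<0$, $\lambda_m=J_{11}-J_{12}<0$, and for every $\beta>0$ the origin is the unique critical point, and it is a maximum point. -/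

import Mathlib

namespace BipartiteMeanField

/-- The entropy function `I(x) = ((1+x) ln(1+x) + (1-x) ln(1-x)) / 2`, for `x ∈ [-1, 1]`. -/
noncomputable def entropy (x : ℝ) : ℝ :=
  (1 / 2) * ((1 + x) * Real.log (1 + x) + (1 - x) * Real.log (1 - x))

/-- The energy density `g` of the two-population mean field model: relative sizes `α` and `1 - α`,
couplings `J11, J12, J22`, external fields `h1, h2`. -/
noncomputable def energy (α J11 J12 J22 h1 h2 : ℝ) (μ : ℝ × ℝ) : ℝ :=
  (1 / 2) * (α ^ 2 * J11 * μ.1 ^ 2 + 2 * α * (1 - α) * J12 * μ.1 * μ.2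
      + (1 - α) ^ 2 * J22 * μ.2 ^ 2)
    + α * h1 * μ.1 + (1 - α) * h2 * μ.2

/-- The pressure functional `f = β g - α I(μ₁) - (1 - α) I(μ₂)`. -/
noncomputable def pressureFunctional (β α J11 J12 J22 h1 h2 : ℝ) (μ : ℝ × ℝ) : ℝ :=
  β * energy α J11 J12 J22 h1 h2 μ - α * entropy μ.1 - (1 - α) * entropy μ.2

/-- The reduced interaction matrix. -/
def reducedMatrix (J11 J12 J22 : ℝ) : Matrix (Fin 2) (Fin 2) ℝ :=
  !![J11, J12; J12, J22]

/-- The set of (real) eigenvalues of the reduced interaction matrix. -/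
def eigenvalueSet (J11 J12 J22 : ℝ) : Set ℝ :=
  {l | Module.End.HasEigenvalue (Matrix.toLin' (reducedMatrix J11 J12 J22)) l}

/-- The critical points of a function of the two magnetizations: the points of the open square
`(-1, 1)²` where its differential exists and vanishes. (The pressure functional lives on the closed
square and is not differentiable on its boundary; values outside the square are meaningless.) -/
def criticalPoints (f : ℝ × ℝ → ℝ) : Set (ℝ × ℝ) :=
  {p | p.1 ∈ Set.Ioo (-1 : ℝ) 1 ∧ p.2 ∈ Set.Ioo (-1 : ℝ) 1 ∧
    HasFDerivAt f (0 : ℝ × ℝ →L[ℝ] ℝ) p}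

/-- An inflection (saddle) point: a critical point that is neither a local maximum nor a local
minimum. -/
def IsInflectionPoint (f : ℝ × ℝ → ℝ) (p : ℝ × ℝ) : Prop :=
  p ∈ criticalPoints f ∧ ¬ IsLocalMax f p ∧ ¬ IsLocalMin f p

/-- `x` is a positive solution of the Curie-Weiss equation `x = tanh (β l x / 2)`. -/
def IsPosSolution (β l x : ℝ) : Prop :=
  0 < x ∧ x = Real.tanh (β * l / 2 * x)

/-- `s ∈ (0, 1)` solves `s artanh(√(1-s)) / √(1-s) = lm / lM`. Outside `(0, 1)` the left side is
not defined. -/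
def IsThreshold (lM lm s : ℝ) : Prop :=
  0 < s ∧ s < 1 ∧ s * Real.artanh (Real.sqrt (1 - s)) / Real.sqrt (1 - s) = lm / lM

end BipartiteMeanField

namespace BipartiteMeanField

open Real Set Filter Topology

/-! ### Hyperbolic functions -/

/-! Put p = βλ_m/2, q = βλ_M/2, let (1, e) with e = ±1 be the eigenvector of λ_M, and let φ_c(x) = c
x²/2 − I(x). The functional equals both (φ_q(x) + φ_q(y))/2 − (q−p)(x − e y)²/8 and (φ_p(x) +
φ_p(y))/2 + (q−p)(x + e y)²/8. The first form yields the maxima at the origin (q ≤ 1) and on the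
line of (1, e); the second yields the minimum at the origin when p > 1.

If p < 1, the critical equations force y = e x, since artanh x − p x is injective, and the scalar
equation artanh x = q x remains. If p > 1, which occurs only with e = −1, set U = artanh x + artanh
y and V = artanh y − artanh x; the equations become `HyperbolicSystem`. The cases U = 0 and V = 0
give the five points on the diagonals. By parity it remains to study U, V > 0, where p sinhc U = q
sinhc V makes V increase with U, while q U coth U + p V coth V = 2pq; hence at most one solution
(`HyperbolicSystem.unique`).

Let w coth w = p. Such a solution exists exactly when q < cosh² w (`HyperbolicSystem.lt_cosh_sq`,
`exists_hyperbolicSystem`), and the same inequality makes (tanh w, tanh w) a maximum rather than a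
saddle. If λ_M/λ_m = sinhc(2w₀), the inequality says w > w₀, equivalently q > cosh² w₀, which is the
threshold with s = 1/cosh² w₀. At the off-diagonal points the Hessian determinant is negative, so
they are not maxima (`HyperbolicSystem.exists_hessianForm_pos`). -/

lemma sinh_lt_mul_cosh {x : ℝ} (hx : 0 < x) : sinh x < x * cosh x := by
  have h : StrictMonoOn (fun x : ℝ => x * cosh x - sinh x) (Ici 0) := by
    refine strictMonoOn_of_deriv_pos (convex_Ici 0) (by fun_prop) fun y hy => ?_
    rw [interior_Ici] at hy
    have hd : HasDerivAt (fun x : ℝ => x * cosh x - sinh x)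
        (1 * cosh y + y * sinh y - cosh y) y :=
      ((hasDerivAt_id y).mul (hasDerivAt_cosh y)).sub (hasDerivAt_sinh y)
    rw [hd.deriv]
    have := mul_pos hy (sinh_pos_iff.2 hy)
    linarith
  have := h (mem_Ici.2 le_rfl) (mem_Ici.2 hx.le) hx
  simp at this
  linarith

/-- The hyperbolic cardinal sine `sinh x / x`, extended by `1` at the origin. -/
noncomputable def sinhc (x : ℝ) : ℝ := dslope sinh 0 x

lemma sinhc_zero : sinhc 0 = 1 := by simp [sinhc]

lemma mul_sinhc (x : ℝ) : x * sinhc x = sinh x := by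
  have := sub_smul_dslope sinh 0 x
  simpa [sinhc] using this

lemma sinhc_of_ne {x : ℝ} (hx : x ≠ 0) : sinhc x = sinh x / x := by
  rw [eq_div_iff hx, mul_comm, mul_sinhc]

lemma continuous_sinhc : Continuous sinhc := by
  have := (continuousOn_dslope (f := sinh) (a := 0) (s := univ) univ_mem).2
    ⟨continuous_sinh.continuousOn, differentiable_sinh 0⟩
  exact continuousOn_univ.1 this

lemma strictMonoOn_sinhc : StrictMonoOn sinhc (Ici 0) := by
  refine strictMonoOn_of_deriv_pos (convex_Ici 0) continuous_sinhc.continuousOn fun y hy => ?_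
  rw [interior_Ici] at hy
  have hy' : 0 < y := hy
  have hd : HasDerivAt sinhc ((cosh y * y - sinh y * 1) / y ^ 2) y := by
    refine ((hasDerivAt_sinh y).div (hasDerivAt_id y) hy'.ne').congr_of_eventuallyEq ?_
    filter_upwards [isOpen_Ioi.mem_nhds hy] with z hz
    exact sinhc_of_ne (ne_of_gt hz)
  rw [hd.deriv]
  have := sinh_lt_mul_cosh hy'
  exact div_pos (by linarith) (by positivity)

lemma one_lt_sinhc {x : ℝ} (hx : 0 < x) : 1 < sinhc x := by
  rw [← sinhc_zero]
  exact strictMonoOn_sinhc (mem_Ici.2 le_rfl) (mem_Ici.2 hx.le) hx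

lemma sinhc_pos {x : ℝ} (hx : 0 ≤ x) : 0 < sinhc x := by
  rcases hx.eq_or_lt with rfl | hx
  · simp [sinhc_zero]
  · exact one_pos.trans (one_lt_sinhc hx)

lemma sinhc_two_mul {x : ℝ} (hx : x ≠ 0) : sinhc (2 * x) = sinh x * cosh x / x := by
  rw [sinhc_of_ne (by simpa using hx), sinh_two_mul]
  field_simp

/-- `sinhc` maps `(0, ∞)` onto `(1, ∞)`. -/
lemma exists_sinhc_eq {R : ℝ} (hR : 1 < R) : ∃ x, 0 < x ∧ sinhc x = R := by
  have h0 : 0 < arcosh R := arcosh_pos hR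
  -- With t = arcosh R, sinhc(2t) = (sinh t / t) cosh t ≥ cosh t = R.
  have h1 : R ≤ sinhc (2 * arcosh R) := by
    rw [sinhc_two_mul h0.ne', le_div_iff₀ h0, cosh_arcosh hR.le]
    nlinarith [self_lt_sinh_iff.2 h0]
  obtain ⟨x, hx, hxR⟩ := intermediate_value_Icc (by positivity : (0 : ℝ) ≤ 2 * arcosh R)
    continuous_sinhc.continuousOn (mem_Icc.2 ⟨sinhc_zero.trans_le hR.le, h1⟩)
  refine ⟨x, lt_of_le_of_ne hx.1 ?_, hxR⟩
  rintro rfl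
  rw [sinhc_zero] at hxR
  exact hR.ne hxR

/-- The numerator of the derivative of y coth y is sinh y cosh y − y, positive because sinh y > y
and cosh y ≥ 1. This monotonicity governs both the Curie-Weiss equation and the threshold. -/
lemma strictMonoOn_mul_cosh_div_sinh :
    StrictMonoOn (fun x : ℝ => x * cosh x / sinh x) (Ioi 0) := by
  have hd : ∀ y : ℝ, 0 < y → HasDerivAt (fun x : ℝ => x * cosh x / sinh x)
      (((1 * cosh y + y * sinh y) * sinh y - (y * cosh y) * cosh y) / sinh y ^ 2) y := fun y hy =>
    ((hasDerivAt_id y).mul (hasDerivAt_cosh y)).div (hasDerivAt_sinh y) (sinh_pos_iff.2 hy).ne'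
  refine strictMonoOn_of_deriv_pos (convex_Ioi 0)
    (fun y hy => (hd y hy).continuousAt.continuousWithinAt) fun y hy => ?_
  rw [interior_Ioi] at hy
  have hy' : 0 < y := hy
  rw [(hd y hy).deriv]
  have h1 := self_lt_sinh_iff.2 hy'
  have h2 := one_le_cosh y
  have h3 := cosh_sq y
  refine div_pos ?_ (by positivity)
  nlinarith

lemma one_lt_mul_cosh_div_sinh {x : ℝ} (hx : 0 < x) : 1 < x * cosh x / sinh x := by
  rw [one_lt_div (sinh_pos_iff.2 hx)]
  exact sinh_lt_mul_cosh hx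

lemma exists_mul_cosh_eq {p : ℝ} (hp : 1 < p) : ∃ w, 0 < w ∧ w * cosh w = p * sinh w := by
  have h0 : 0 < arcosh p := arcosh_pos hp
  have hp0 : 0 < p := one_pos.trans hp
  -- The difference is negative at p, as sinh < cosh, and positive at arcosh p, where it equals
  -- p(sinh w − w). An unordered interval avoids comparing the two endpoints.
  have hc : ContinuousOn (fun w : ℝ => p * sinh w - w * cosh w) (uIcc p (arcosh p)) := by fun_prop
  have hs : (0 : ℝ) ∈ uIcc (p * sinh p - p * cosh p)
      (p * sinh (arcosh p) - arcosh p * cosh (arcosh p)) := by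
    rw [mem_uIcc]
    left
    constructor
    · nlinarith [sinh_lt_cosh p]
    · rw [cosh_arcosh hp.le]
      nlinarith [self_lt_sinh_iff.2 h0]
  obtain ⟨w, hw, hw0⟩ := intermediate_value_uIcc hc hs
  refine ⟨w, ?_, by simpa using (sub_eq_zero.1 hw0).symm⟩
  exact (lt_min hp0 h0).trans_le (by simpa [uIcc, mem_Icc] using hw.1)

/-- By the double-angle formula p sinhc(2w) = (p sinh w) cosh w / w. This identity is what makes
cosh² w the critical value of q. -/
lemma mul_sinhc_two_mul_eq {p w : ℝ} (hw : 0 < w) (hpw : w * cosh w = p * sinh w) :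
    p * sinhc (2 * w) = cosh w ^ 2 := by
  rw [sinhc_two_mul hw.ne', ← mul_div_assoc, div_eq_iff hw.ne', ← mul_assoc, ← hpw]
  ring

/-! ### The inverse hyperbolic tangent and the entropy -/

lemma hasDerivAt_artanh {x : ℝ} (hx : x ∈ Ioo (-1 : ℝ) 1) :
    HasDerivAt artanh (1 / (1 - x ^ 2)) x := by
  have h1 : 0 < 1 + x := by linarith [hx.1]
  have h2 : 0 < 1 - x := by linarith [hx.2]
  have h : HasDerivAt (fun y : ℝ => 1 / 2 * (log (1 + y) - log (1 - y)))
      (1 / 2 * (1 / (1 + x) - (-1) / (1 - x))) x :=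
    ((((hasDerivAt_id x).const_add 1).log h1.ne').sub
      (((hasDerivAt_id x).const_sub 1).log h2.ne')).const_mul (1 / 2)
  have h3 : artanh =ᶠ[𝓝 x] fun y : ℝ => 1 / 2 * (log (1 + y) - log (1 - y)) := by
    filter_upwards [isOpen_Ioo.mem_nhds hx] with y hy
    rw [artanh_eq_half_log ⟨hy.1.le, hy.2.le⟩, log_div] <;> linarith [hy.1, hy.2]
  have h4 : 1 / (1 - x ^ 2) = 1 / 2 * (1 / (1 + x) - (-1) / (1 - x)) := by
    rw [show 1 - x ^ 2 = (1 + x) * (1 - x) by ring]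
    field_simp
    ring
  rw [h4]
  exact h.congr_of_eventuallyEq h3

lemma artanh_odd {x : ℝ} (hx : x ∈ Ioo (-1 : ℝ) 1) : artanh (-x) = -artanh x := by
  apply tanh_injective
  rw [tanh_neg, tanh_artanh hx, tanh_artanh (by constructor <;> linarith [hx.1, hx.2])]

lemma tanh_mem_Ioo (u : ℝ) : tanh u ∈ Ioo (-1 : ℝ) 1 := ⟨neg_one_lt_tanh u, tanh_lt_one u⟩

lemma tanh_pos {u : ℝ} (hu : 0 < u) : 0 < tanh u := by
  rw [tanh_eq_sinh_div_cosh]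
  exact div_pos (sinh_pos_iff.2 hu) (cosh_pos u)

lemma tanh_strictMono : StrictMono tanh := fun x y h => by
  rw [← artanh_lt_artanh_iff (tanh_mem_Ioo x) (tanh_mem_Ioo y), artanh_tanh, artanh_tanh]
  exact h

lemma one_sub_tanh_sq (u : ℝ) : 1 - tanh u ^ 2 = 1 / cosh u ^ 2 := by
  have := cosh_sq u
  have hc := cosh_pos u
  rw [tanh_eq_sinh_div_cosh, div_pow, eq_div_iff (by positivity), sub_mul,
    div_mul_cancel₀ _ (by positivity)]
  linarith

/-- The inverse hyperbolic tangent grows at least at unit rate. -/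
lemma strictMonoOn_artanh_sub : StrictMonoOn (fun x => artanh x - x) (Ioo (-1) 1) := by
  intro x hx y hy hxy
  -- The derivative 1/(1 − t²) − 1 vanishes at 0, so monotonicity is proved on [0, 1) and carried
  -- across the origin by oddness.
  have key : ∀ z w : ℝ, 0 ≤ z → z < w → w < 1 → artanh z - z < artanh w - w := by
    intro z w hz hzw hw
    have hm : StrictMonoOn (fun x => artanh x - x) (Ico 0 1) := by
      have hd : ∀ t ∈ Ico (0 : ℝ) 1, HasDerivAt (fun x => artanh x - x) (1 / (1 - t ^ 2) - 1) t :=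
        fun t ht => (hasDerivAt_artanh ⟨by linarith [ht.1], ht.2⟩).sub (hasDerivAt_id t)
      refine strictMonoOn_of_deriv_pos (convex_Ico 0 1)
        (fun t ht => (hd t ht).continuousAt.continuousWithinAt) fun t ht => ?_
      rw [interior_Ico] at ht
      rw [(hd t ⟨ht.1.le, ht.2⟩).deriv, sub_pos, lt_div_iff₀] <;> nlinarith [ht.1, ht.2]
    exact hm ⟨hz, hzw.trans hw⟩ ⟨hz.trans hzw.le, hw⟩ hzw
  have hodd : ∀ z ∈ Ioo (-1 : ℝ) 1, artanh (-z) = -artanh z := fun z hz => artanh_odd hz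
  simp only
  rcases le_or_gt 0 x with h0 | h0
  · exact key x y h0 hxy hy.2
  rcases le_or_gt y 0 with h1 | h1
  · have := key (-y) (-x) (by linarith) (by linarith) (by linarith [hx.1])
    rw [hodd x hx, hodd y hy] at this
    linarith
  · have h2 := key 0 (-x) le_rfl (by linarith) (by linarith [hx.1])
    have h3 := key 0 y le_rfl h1 hy.2
    rw [hodd x hx] at h2
    rw [artanh_zero] at h2 h3
    linarith

lemma hasDerivAt_entropy {x : ℝ} (hx : x ∈ Ioo (-1 : ℝ) 1) :
    HasDerivAt entropy (artanh x) x := by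
  have h1 : 0 < 1 + x := by linarith [hx.1]
  have h2 : 0 < 1 - x := by linarith [hx.2]
  have h3 : HasDerivAt (fun y : ℝ => 1 + y) 1 x := (hasDerivAt_id x).const_add 1
  have h4 : HasDerivAt (fun y : ℝ => 1 - y) (-1) x := (hasDerivAt_id x).const_sub 1
  have h : HasDerivAt entropy (1 / 2 * ((1 * log (1 + x) + (1 + x) * (1 / (1 + x))) +
      ((-1) * log (1 - x) + (1 - x) * ((-1) / (1 - x))))) x :=
    ((h3.mul (h3.log h1.ne')).add (h4.mul (h4.log h2.ne'))).const_mul (1 / 2)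
  convert h using 1
  rw [artanh_eq_half_log ⟨hx.1.le, hx.2.le⟩, log_div h1.ne' h2.ne']
  field_simp
  ring

lemma entropy_neg (x : ℝ) : entropy (-x) = entropy x := by
  simp only [entropy, sub_neg_eq_add, ← sub_eq_add_neg]
  ring

lemma entropy_zero : entropy 0 = 0 := by simp [entropy]

/-! ### The one-population potential -/

/-- The potential `c x² / 2 - I(x)` of a single population. -/
noncomputable def singlePotential (c x : ℝ) : ℝ := c * x ^ 2 / 2 - entropy x

lemma singlePotential_neg (c x : ℝ) : singlePotential c (-x) = singlePotential c x := by
  simp [singlePotential, entropy_neg]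

lemma singlePotential_zero (c : ℝ) : singlePotential c 0 = 0 := by
  simp [singlePotential, entropy_zero]

lemma hasDerivAt_singlePotential (c : ℝ) {x : ℝ} (hx : x ∈ Ioo (-1 : ℝ) 1) :
    HasDerivAt (singlePotential c) (c * x - artanh x) x := by
  have h1 : HasDerivAt (fun x : ℝ => c * x ^ 2 / 2) (c * (2 * x) / 2) x := by
    have h := (((hasDerivAt_pow 2 x).const_mul c).div_const 2)
    simpa using h
  have h : HasDerivAt (singlePotential c) (c * (2 * x) / 2 - artanh x) x :=
    h1.sub (hasDerivAt_entropy hx)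
  rwa [show c * (2 * x) / 2 = c * x by ring] at h

lemma self_le_artanh {x : ℝ} (hx : x ∈ Ico (0 : ℝ) 1) : x ≤ artanh x := by
  have := strictMonoOn_artanh_sub.monotoneOn (a := 0) (by simp) ⟨by linarith [hx.1], hx.2⟩ hx.1
  simp only [artanh_zero] at this
  linarith

lemma self_lt_artanh {x : ℝ} (hx : x ∈ Ioo (0 : ℝ) 1) : x < artanh x := by
  have := strictMonoOn_artanh_sub (a := 0) (by simp) ⟨by linarith [hx.1], hx.2⟩ hx.1
  simp only [artanh_zero] at this
  linarith

/-- If `c ≤ 1`, the potential of a single population is nonpositive. -/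
lemma singlePotential_nonpos {c x : ℝ} (hc : c ≤ 1) (hx : x ∈ Ioo (-1 : ℝ) 1) :
    singlePotential c x ≤ 0 := by
  have key : ∀ y ∈ Ico (0 : ℝ) 1, singlePotential c y ≤ 0 := by
    intro y hy
    have hd : ∀ t ∈ Ico (0 : ℝ) 1, HasDerivAt (singlePotential c) (c * t - artanh t) t :=
      fun t ht => hasDerivAt_singlePotential c ⟨by linarith [ht.1], ht.2⟩
    have ha : AntitoneOn (singlePotential c) (Ico 0 1) := by
      refine antitoneOn_of_deriv_nonpos (convex_Ico 0 1)
        (fun t ht => (hd t ht).continuousAt.continuousWithinAt)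
        (fun t ht => (hd t (interior_subset ht)).differentiableAt.differentiableWithinAt)
        fun t ht => ?_
      rw [(hd t (interior_subset ht)).deriv]
      have h1 := interior_subset ht
      have h2 := self_le_artanh h1
      nlinarith [h1.1]
    rw [← singlePotential_zero c]
    exact ha ⟨le_rfl, one_pos⟩ hy hy.1
  rcases le_total 0 x with h | h
  · exact key x ⟨h, hx.2⟩
  · rw [← singlePotential_neg]
    exact key (-x) ⟨by linarith, by linarith [hx.1]⟩

/-! ### The one-population equation with c = w coth w -/

section Root

variable {c w : ℝ}

/-- For x = tanh u the inequality reads u coth u < c = w coth w, which is the monotonicity of u coth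
u. -/
lemma artanh_lt_mul (hw : 0 < w) (hc : w * cosh w = c * sinh w) {x : ℝ} (h0 : 0 < x)
    (hx : x < tanh w) : artanh x < c * x := by
  have hx1 : x ∈ Ioo (-1 : ℝ) 1 := ⟨by linarith, hx.trans (tanh_lt_one w)⟩
  obtain ⟨u, rfl⟩ : ∃ u, x = tanh u := ⟨_, (tanh_artanh hx1).symm⟩
  have hu : 0 < u := by
    rw [← tanh_zero] at h0
    exact tanh_strictMono.lt_iff_lt.1 h0
  have h1 := strictMonoOn_mul_cosh_div_sinh hu hw (tanh_strictMono.lt_iff_lt.1 hx)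
  simp only at h1
  rw [hc, mul_div_cancel_right₀ _ (sinh_pos_iff.2 hw).ne', div_lt_iff₀ (sinh_pos_iff.2 hu)] at h1
  rw [artanh_tanh, tanh_eq_sinh_div_cosh, ← mul_div_assoc, lt_div_iff₀ (cosh_pos u)]
  exact h1

lemma mul_lt_artanh (hw : 0 < w) (hc : w * cosh w = c * sinh w) {x : ℝ} (hx : tanh w < x)
    (h1 : x < 1) : c * x < artanh x := by
  have hx1 : x ∈ Ioo (-1 : ℝ) 1 := ⟨by linarith [tanh_pos hw], h1⟩
  obtain ⟨u, rfl⟩ : ∃ u, x = tanh u := ⟨_, (tanh_artanh hx1).symm⟩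
  have hwu := tanh_strictMono.lt_iff_lt.1 hx
  have hu : 0 < u := hw.trans hwu
  have h1 := strictMonoOn_mul_cosh_div_sinh hw hu hwu
  simp only at h1
  rw [hc, mul_div_cancel_right₀ _ (sinh_pos_iff.2 hw).ne', lt_div_iff₀ (sinh_pos_iff.2 hu)] at h1
  rw [artanh_tanh, tanh_eq_sinh_div_cosh, ← mul_div_assoc, div_lt_iff₀ (cosh_pos u)]
  exact h1

lemma artanh_tanh_eq_mul (hc : w * cosh w = c * sinh w) : artanh (tanh w) = c * tanh w := by
  rw [artanh_tanh, tanh_eq_sinh_div_cosh, ← mul_div_assoc, eq_div_iff (cosh_pos w).ne', hc]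

/-- The solutions of the Curie-Weiss equation above the critical temperature. -/
lemma artanh_eq_mul_iff (hw : 0 < w) (hc : w * cosh w = c * sinh w) {x : ℝ}
    (hx : x ∈ Ioo (-1 : ℝ) 1) : artanh x = c * x ↔ x = 0 ∨ x = tanh w ∨ x = -tanh w := by
  have key : ∀ y, 0 < y → y < 1 → artanh y = c * y → y = tanh w := by
    intro y h0 h1 h
    rcases lt_trichotomy y (tanh w) with h2 | h2 | h2
    · exact absurd h (artanh_lt_mul hw hc h0 h2).ne
    · exact h2
    · exact absurd h (mul_lt_artanh hw hc h2 h1).ne'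
  constructor
  · intro h
    rcases lt_trichotomy x 0 with h0 | h0 | h0
    · right; right
      rw [← key (-x) (by linarith) (by linarith [hx.1]) (by rw [artanh_odd hx, h]; ring), neg_neg]
    · exact Or.inl h0
    · exact Or.inr (Or.inl (key x h0 hx.2 h))
  · rintro (rfl | rfl | rfl)
    · simp [artanh_zero]
    · exact artanh_tanh_eq_mul hc
    · rw [artanh_odd (tanh_mem_Ioo w), artanh_tanh_eq_mul hc]; ring

lemma singlePotential_le (hw : 0 < w) (hc : w * cosh w = c * sinh w) {x : ℝ}
    (hx : x ∈ Ioo (-1 : ℝ) 1) : singlePotential c x ≤ singlePotential c (tanh w) := by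
  have hd : ∀ t ∈ Ico (0 : ℝ) 1, HasDerivAt (singlePotential c) (c * t - artanh t) t :=
    fun t ht => hasDerivAt_singlePotential c ⟨by linarith [ht.1], ht.2⟩
  have hw' := tanh_pos hw
  have hw1 := tanh_lt_one w
  have hm : IsMaxOn (singlePotential c) (Ico 0 1) (tanh w) := by
    have hl : ∀ t ∈ Ioo 0 (tanh w), t ∈ Ico (0 : ℝ) 1 := fun t ht => ⟨ht.1.le, ht.2.trans hw1⟩
    have hr : ∀ t ∈ Ioo (tanh w) 1, t ∈ Ico (0 : ℝ) 1 := fun t ht => ⟨(hw'.trans ht.1).le, ht.2⟩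
    refine isMaxOn_Ico_of_deriv (hd 0 (by simp)).continuousAt (hd _ ⟨hw'.le, hw1⟩).continuousAt
      (fun t ht => (hd t (hl t ht)).differentiableAt.differentiableWithinAt)
      (fun t ht => (hd t (hr t ht)).differentiableAt.differentiableWithinAt) ?_ ?_
    · intro t ht
      rw [(hd t (hl t ht)).deriv]
      exact sub_nonneg.2 (artanh_lt_mul hw hc ht.1 ht.2).le
    · intro t ht
      rw [(hd t (hr t ht)).deriv]
      exact sub_nonpos.2 (mul_lt_artanh hw hc ht.1 ht.2).le
  rcases le_total 0 x with h | h
  · exact hm ⟨h, hx.2⟩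
  · rw [← singlePotential_neg]
    exact hm (⟨by linarith, by linarith [hx.1]⟩ : -x ∈ Ico (0 : ℝ) 1)

lemma singlePotential_nonneg (hw : 0 < w) (hc : w * cosh w = c * sinh w) {x : ℝ}
    (hx : x ∈ Ioo (-tanh w) (tanh w)) : 0 ≤ singlePotential c x := by
  have hd : ∀ t ∈ Ico (0 : ℝ) (tanh w), HasDerivAt (singlePotential c) (c * t - artanh t) t :=
    fun t ht => hasDerivAt_singlePotential c ⟨by linarith [ht.1], ht.2.trans (tanh_lt_one w)⟩
  have hm : MonotoneOn (singlePotential c) (Ico 0 (tanh w)) := by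
    refine monotoneOn_of_deriv_nonneg (convex_Ico _ _)
      (fun t ht => (hd t ht).continuousAt.continuousWithinAt)
      (fun t ht => (hd t (interior_subset ht)).differentiableAt.differentiableWithinAt)
      fun t ht => ?_
    rw [(hd t (interior_subset ht)).deriv]
    rw [interior_Ico] at ht
    exact sub_nonneg.2 (artanh_lt_mul hw hc ht.1 ht.2).le
  rw [← singlePotential_zero c]
  rcases le_total 0 x with h | h
  · exact hm ⟨le_rfl, tanh_pos hw⟩ ⟨h, hx.2⟩ h
  · rw [← singlePotential_neg c x]
    exact hm ⟨le_rfl, tanh_pos hw⟩ ⟨by linarith, by linarith [hx.1]⟩ (by linarith)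

end Root

/-- Where the second derivative is negative, the potential lies locally below its tangent. -/
lemma singlePotential_le_tangent {c y : ℝ} (hy : y ∈ Ioo (-1 : ℝ) 1) (hc : c < 1 / (1 - y ^ 2)) :
    ∀ᶠ x in 𝓝 y,
      singlePotential c x ≤ singlePotential c y + (c * y - artanh y) * (x - y) := by
  -- Subtracting the tangent makes y a critical point with second derivative c − 1/(1 − y²) < 0.
  set g : ℝ → ℝ := fun x => singlePotential c x - (c * y - artanh y) * (x - y) with hg
  have hd : ∀ x ∈ Ioo (-1 : ℝ) 1, HasDerivAt g ((c * x - artanh x) - (c * y - artanh y)) x := by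
    intro x hx
    have h : HasDerivAt g ((c * x - artanh x) - (c * y - artanh y) * 1) x :=
      (hasDerivAt_singlePotential c hx).sub
        (((hasDerivAt_id x).sub_const y).const_mul (c * y - artanh y))
    rwa [mul_one] at h
  have hdd : deriv g =ᶠ[𝓝 y] fun x => (c * x - artanh x) - (c * y - artanh y) := by
    filter_upwards [isOpen_Ioo.mem_nhds hy] with x hx using (hd x hx).deriv
  have h2 : HasDerivAt (fun x => (c * x - artanh x) - (c * y - artanh y))
      (c - 1 / (1 - y ^ 2)) y := by
    have h : HasDerivAt (fun x => (c * x - artanh x) - (c * y - artanh y))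
        (c * 1 - 1 / (1 - y ^ 2)) y :=
      (((hasDerivAt_id y).const_mul c).sub (hasDerivAt_artanh hy)).sub_const _
    rwa [mul_one] at h
  have hmax : IsLocalMax g y := by
    refine isLocalMax_of_deriv_deriv_neg ?_ ?_ (hd y hy).continuousAt
    · rw [hdd.deriv_eq, h2.deriv]
      linarith
    · rw [(hd y hy).deriv, sub_self]
  filter_upwards [hmax] with x hx
  simp only [hg, sub_self, mul_zero, sub_zero] at hx
  linarith

/-! ### The two-population potential -/

/-- The pressure functional in the symmetric case, in terms of the two eigenvalues; `e` is the sign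
of the eigenvector `(1, e)` that belongs to `q`. -/
noncomputable def pairPotential (p q e : ℝ) (z : ℝ × ℝ) : ℝ :=
  (singlePotential q z.1 + singlePotential q z.2) / 2 - (q - p) / 8 * (z.1 - e * z.2) ^ 2

/-- The complementary decomposition: the definition bounds the functional from above by φ_q when p ≤
q, and this form bounds it from below by φ_p. -/
lemma pairPotential_eq {p q e : ℝ} (he : e ^ 2 = 1) (z : ℝ × ℝ) :
    pairPotential p q e z =
      (singlePotential p z.1 + singlePotential p z.2) / 2 + (q - p) / 8 * (z.1 + e * z.2) ^ 2 := by
  simp only [pairPotential, singlePotential]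
  linear_combination (p - q) / 4 * z.2 ^ 2 * he

lemma pairPotential_neg (p q e : ℝ) (z : ℝ × ℝ) :
    pairPotential p q e (-z) = pairPotential p q e z := by
  simp only [pairPotential, Prod.fst_neg, Prod.snd_neg, singlePotential_neg]
  ring

lemma pairPotential_swap {p q e : ℝ} (he : e ^ 2 = 1) (z : ℝ × ℝ) :
    pairPotential p q e z.swap = pairPotential p q e z := by
  simp only [pairPotential, Prod.fst_swap, Prod.snd_swap]
  linear_combination (p - q) / 8 * (z.1 ^ 2 - z.2 ^ 2) * he

/-- The open square. -/
def square : Set (ℝ × ℝ) := Ioo (-1) 1 ×ˢ Ioo (-1) 1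

lemma square_mem_nhds {z : ℝ × ℝ} (hz : z ∈ square) : square ∈ 𝓝 z :=
  (isOpen_Ioo.prod isOpen_Ioo).mem_nhds hz

lemma zero_mem_square : ((0, 0) : ℝ × ℝ) ∈ square := by simp [square]

lemma hasFDerivAt_pairPotential {p q e : ℝ} (he : e ^ 2 = 1) {z : ℝ × ℝ} (hz : z ∈ square) :
    HasFDerivAt (pairPotential p q e)
      ((((p + q) / 2 * z.1 + e * (q - p) / 2 * z.2 - artanh z.1) / 2) •
          ContinuousLinearMap.fst ℝ ℝ ℝ +
        (((p + q) / 2 * z.2 + e * (q - p) / 2 * z.1 - artanh z.2) / 2) •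
          ContinuousLinearMap.snd ℝ ℝ ℝ) z := by
  have h1 := (hasDerivAt_singlePotential q hz.1).comp_hasFDerivAt z
    (hasFDerivAt_fst (𝕜 := ℝ) (p := z))
  have h2 := (hasDerivAt_singlePotential q hz.2).comp_hasFDerivAt z
    (hasFDerivAt_snd (𝕜 := ℝ) (p := z))
  have h3 := ((hasFDerivAt_fst (𝕜 := ℝ) (p := z)).sub
    ((hasFDerivAt_snd (𝕜 := ℝ) (p := z)).const_mul e)).pow 2
  have h := ((h1.add h2).const_mul (1 / 2)).sub (h3.const_mul ((q - p) / 8))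
  have hf : pairPotential p q e = fun z : ℝ × ℝ =>
      1 / 2 * (singlePotential q z.1 + singlePotential q z.2)
        - (q - p) / 8 * (z.1 - e * z.2) ^ 2 := by
    funext z
    simp only [pairPotential]
    ring
  rw [hf]
  refine h.congr_fderiv ?_
  ext
  · simp
    ring
  · simp
    linear_combination (p - q) / 4 * z.2 * he

lemma mem_criticalPoints_pairPotential {p q e : ℝ} (he : e ^ 2 = 1) {z : ℝ × ℝ} :
    z ∈ criticalPoints (pairPotential p q e) ↔ z ∈ square ∧
      artanh z.1 = (p + q) / 2 * z.1 + e * (q - p) / 2 * z.2 ∧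
      artanh z.2 = (p + q) / 2 * z.2 + e * (q - p) / 2 * z.1 := by
  constructor
  · rintro ⟨h1, h2, h⟩
    refine ⟨⟨h1, h2⟩, ?_⟩
    have hu := h.unique (hasFDerivAt_pairPotential he ⟨h1, h2⟩)
    have e1 := DFunLike.congr_fun hu ((1, 0) : ℝ × ℝ)
    have e2 := DFunLike.congr_fun hu ((0, 1) : ℝ × ℝ)
    simp at e1 e2
    constructor <;> linarith
  · rintro ⟨hz, e1, e2⟩
    refine ⟨hz.1, hz.2, (hasFDerivAt_pairPotential he hz).congr_fderiv ?_⟩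
    rw [e1, e2]
    simp

lemma IsLocalMax.neg_of_even {f : ℝ × ℝ → ℝ} (hf : ∀ z, f (-z) = f z) {z : ℝ × ℝ}
    (h : IsLocalMax f z) : IsLocalMax f (-z) := by
  have ht : Tendsto (fun y : ℝ × ℝ => -y) (𝓝 (-z)) (𝓝 z) := by
    simpa using (continuous_neg (G := ℝ × ℝ)).tendsto (-z)
  filter_upwards [ht.eventually h] with y hy
  rw [hf z, ← hf y]
  exact hy

lemma IsLocalMin.neg_of_even {f : ℝ × ℝ → ℝ} (hf : ∀ z, f (-z) = f z) {z : ℝ × ℝ}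
    (h : IsLocalMin f z) : IsLocalMin f (-z) := by
  have ht : Tendsto (fun y : ℝ × ℝ => -y) (𝓝 (-z)) (𝓝 z) := by
    simpa using (continuous_neg (G := ℝ × ℝ)).tendsto (-z)
  filter_upwards [ht.eventually h] with y hy
  rw [hf z, ← hf y]
  exact hy

lemma IsLocalMax.swap_of_symm {f : ℝ × ℝ → ℝ} (hf : ∀ z : ℝ × ℝ, f z.swap = f z) {z : ℝ × ℝ}
    (h : IsLocalMax f z) : IsLocalMax f z.swap := by
  have ht : Tendsto (fun y : ℝ × ℝ => y.swap) (𝓝 z.swap) (𝓝 z) := by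
    simpa using (continuous_swap (X := ℝ) (Y := ℝ)).tendsto z.swap
  filter_upwards [ht.eventually h] with y hy
  rw [hf z, ← hf y]
  exact hy

/-! #### Local maxima and minima -/

/-- Both terms of the definition are nonpositive, so the degenerate case q = 1 is covered without a
Hessian. -/
lemma isLocalMax_zero {p q e : ℝ} (hpq : p ≤ q) (hq : q ≤ 1) :
    IsLocalMax (pairPotential p q e) (0, 0) := by
  filter_upwards [square_mem_nhds zero_mem_square] with z hz
  have h1 := singlePotential_nonpos hq hz.1
  have h2 := singlePotential_nonpos hq hz.2
  have h3 : 0 ≤ (q - p) / 8 * (z.1 - e * z.2) ^ 2 := by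
    have : 0 ≤ q - p := by linarith
    positivity
  simp only [pairPotential, singlePotential_zero]
  linarith

lemma isLocalMin_zero {p q e w : ℝ} (he : e ^ 2 = 1) (hpq : p ≤ q) (hw : 0 < w)
    (hp : w * cosh w = p * sinh w) : IsLocalMin (pairPotential p q e) (0, 0) := by
  have hn : Ioo (-tanh w) (tanh w) ×ˢ Ioo (-tanh w) (tanh w) ∈ 𝓝 ((0, 0) : ℝ × ℝ) :=
    (isOpen_Ioo.prod isOpen_Ioo).mem_nhds (by simp [tanh_pos hw])
  filter_upwards [hn] with z hz
  have h1 := singlePotential_nonneg hw hp hz.1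
  have h2 := singlePotential_nonneg hw hp hz.2
  have h3 : 0 ≤ (q - p) / 8 * (z.1 + e * z.2) ^ 2 := by
    have : 0 ≤ q - p := by linarith
    positivity
  rw [pairPotential_eq he, pairPotential_eq he]
  simp only [singlePotential_zero, mul_zero, add_zero]
  linarith

/-- At this point the square (x − e y)² vanishes and both copies of φ_q attain their maximum over
(−1, 1), so the point even maximizes over the open square. -/
lemma isLocalMax_of_major {p q e w : ℝ} (he : e ^ 2 = 1) (hpq : p ≤ q) (hw : 0 < w)
    (hq : w * cosh w = q * sinh w) : IsLocalMax (pairPotential p q e) (tanh w, e * tanh w) := by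
  have hv : pairPotential p q e (tanh w, e * tanh w) = singlePotential q (tanh w) := by
    have h : singlePotential q (e * tanh w) = singlePotential q (tanh w) := by
      rcases mul_self_eq_one_iff.1 ((sq e).symm.trans he) with rfl | rfl
      · rw [one_mul]
      · rw [neg_one_mul, singlePotential_neg]
    simp only [pairPotential, h]
    linear_combination (p - q) / 8 * (tanh w) ^ 2 * (e ^ 2 - 1) * he
  have hm : (tanh w, e * tanh w) ∈ square := by
    refine ⟨tanh_mem_Ioo w, ?_⟩
    have := tanh_mem_Ioo w
    rcases mul_self_eq_one_iff.1 ((sq e).symm.trans he) with rfl | rfl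
    · simpa using this
    · constructor <;> linarith [this.1, this.2]
  filter_upwards [square_mem_nhds hm] with z hz
  rw [hv]
  have h1 := singlePotential_le hw hq hz.1
  have h2 := singlePotential_le hw hq hz.2
  have h3 : 0 ≤ (q - p) / 8 * (z.1 - e * z.2) ^ 2 := by
    have : 0 ≤ q - p := by linarith
    positivity
  simp only [pairPotential]
  linarith

lemma isLocalMax_of_minor {p q w : ℝ} (hpq : p ≤ q) (hp : w * cosh w = p * sinh w)
    (hq : q < cosh w ^ 2) : IsLocalMax (pairPotential p q (-1)) (tanh w, tanh w) := by
  have ht := singlePotential_le_tangent (c := q) (tanh_mem_Ioo w)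
    (by rw [one_sub_tanh_sq, one_div_one_div]; exact hq)
  have h1 : ∀ᶠ z : ℝ × ℝ in 𝓝 (tanh w, tanh w), _ := continuousAt_fst.eventually ht
  have h2 : ∀ᶠ z : ℝ × ℝ in 𝓝 (tanh w, tanh w), _ := continuousAt_snd.eventually ht
  filter_upwards [h1, h2] with z hz1 hz2
  -- The tangent of φ_q at t = tanh w has slope (q − p)t. The two tangent bounds and the quadratic
  -- coupling then combine to −(q − p)(x + y − 2t)²/8.
  rw [artanh_tanh_eq_mul hp] at hz1 hz2
  simp only [pairPotential]
  have h3 : 0 ≤ (q - p) / 8 * (z.1 + z.2 - 2 * tanh w) ^ 2 := by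
    have : 0 ≤ q - p := by linarith
    positivity
  nlinarith

/-! #### Second-order conditions -/

/-- A positive second derivative makes a a local minimum; if it were also a local maximum, φ would
be locally constant and c would be 0. -/
lemma not_isLocalMax_of_hasDerivAt {φ g : ℝ → ℝ} {a c : ℝ}
    (h : ∀ᶠ s in 𝓝 a, HasDerivAt φ (g s) s) (h0 : g a = 0) (hg : HasDerivAt g c a) (hc : 0 < c) :
    ¬ IsLocalMax φ a := by
  intro hmax
  have hd : deriv φ =ᶠ[𝓝 a] g := h.mono fun s hs => hs.deriv
  have hmin : IsLocalMin φ a := by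
    refine isLocalMin_of_deriv_deriv_pos ?_ ?_ h.self_of_nhds.continuousAt
    · rwa [hd.deriv_eq, hg.deriv]
    · rw [hd.eq_of_nhds, h0]
  have he : φ =ᶠ[𝓝 a] fun _ => φ a := by
    filter_upwards [hmax, hmin] with s h1 h2 using le_antisymm h1 h2
  have h1 : g =ᶠ[𝓝 a] fun _ => 0 := by
    have := hd.symm.trans he.deriv
    simpa using this
  have h2 := h1.deriv_eq
  rw [hg.deriv, deriv_const] at h2
  exact hc.ne' h2

lemma not_isLocalMin_of_hasDerivAt {φ g : ℝ → ℝ} {a c : ℝ}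
    (h : ∀ᶠ s in 𝓝 a, HasDerivAt φ (g s) s) (h0 : g a = 0) (hg : HasDerivAt g c a) (hc : c < 0) :
    ¬ IsLocalMin φ a := fun hmin =>
  not_isLocalMax_of_hasDerivAt (φ := -φ) (g := -g) (h.mono fun _ hs => hs.neg) (by simp [h0])
    hg.neg (neg_pos.2 hc) hmin.neg

/-- The Hessian form of `pairPotential`, up to a factor `2`. -/
noncomputable def hessianForm (p q e : ℝ) (z v : ℝ × ℝ) : ℝ :=
  (p + q) / 2 * (v.1 ^ 2 + v.2 ^ 2) + e * (q - p) * v.1 * v.2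
    - v.1 ^ 2 / (1 - z.1 ^ 2) - v.2 ^ 2 / (1 - z.2 ^ 2)

/-- Restriction to the line through z in direction v reduces second-order conditions to the
one-variable test. -/
lemma exists_hasDerivAt_line {p q e : ℝ} (he : e ^ 2 = 1) {z : ℝ × ℝ}
    (hz : z ∈ criticalPoints (pairPotential p q e)) (v : ℝ × ℝ) :
    ∃ g : ℝ → ℝ, (∀ᶠ s in 𝓝 0, HasDerivAt (fun s : ℝ => pairPotential p q e (z + s • v)) (g s) s) ∧
      g 0 = 0 ∧ HasDerivAt g (hessianForm p q e z v / 2) 0 := by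
  obtain ⟨hs, h1, h2⟩ := (mem_criticalPoints_pairPotential he).1 hz
  refine ⟨fun s =>
    (((p + q) / 2 * (z.1 + s * v.1) + e * (q - p) / 2 * (z.2 + s * v.2) - artanh (z.1 + s * v.1)) / 2)
        * v.1 +
      (((p + q) / 2 * (z.2 + s * v.2) + e * (q - p) / 2 * (z.1 + s * v.1)
        - artanh (z.2 + s * v.2)) / 2) * v.2, ?_, ?_, ?_⟩
  · have hc : ContinuousAt (fun s : ℝ => z + s • v) 0 := by fun_prop
    have hn : square ∈ 𝓝 (z + (0 : ℝ) • v) := by simpa using square_mem_nhds hs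
    filter_upwards [hc.preimage_mem_nhds hn] with s hs'
    have hl : HasDerivAt (fun s : ℝ => z + s • v) v s := by
      simpa using ((hasDerivAt_id s).smul_const v).const_add z
    have hd := (hasFDerivAt_pairPotential (p := p) (q := q) he hs').comp_hasDerivAt s hl
    exact hd.congr_deriv (by simp)
  · simp only [zero_mul, add_zero]
    rw [h1, h2]
    ring
  · have l1 : HasDerivAt (fun s : ℝ => z.1 + s * v.1) v.1 0 := by
      simpa using ((hasDerivAt_id (0 : ℝ)).mul_const v.1).const_add z.1
    have l2 : HasDerivAt (fun s : ℝ => z.2 + s * v.2) v.2 0 := by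
      simpa using ((hasDerivAt_id (0 : ℝ)).mul_const v.2).const_add z.2
    have a1 : HasDerivAt (fun s : ℝ => artanh (z.1 + s * v.1)) (1 / (1 - z.1 ^ 2) * v.1) 0 := by
      have : HasDerivAt artanh (1 / (1 - z.1 ^ 2)) (z.1 + 0 * v.1) := by
        simpa using hasDerivAt_artanh hs.1
      exact HasDerivAt.comp (h₂ := artanh) (0 : ℝ) this l1
    have a2 : HasDerivAt (fun s : ℝ => artanh (z.2 + s * v.2)) (1 / (1 - z.2 ^ 2) * v.2) 0 := by
      have : HasDerivAt artanh (1 / (1 - z.2 ^ 2)) (z.2 + 0 * v.2) := by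
        simpa using hasDerivAt_artanh hs.2
      exact HasDerivAt.comp (h₂ := artanh) (0 : ℝ) this l2
    have := (((((l1.const_mul ((p + q) / 2)).add (l2.const_mul (e * (q - p) / 2))).sub a1).div_const
      2).mul_const v.1).add
      (((((l2.const_mul ((p + q) / 2)).add (l1.const_mul (e * (q - p) / 2))).sub a2).div_const
      2).mul_const v.2)
    have hval : hessianForm p q e z v / 2 =
        ((p + q) / 2 * v.1 + e * (q - p) / 2 * v.2 - 1 / (1 - z.1 ^ 2) * v.1) / 2 * v.1 +
        ((p + q) / 2 * v.2 + e * (q - p) / 2 * v.1 - 1 / (1 - z.2 ^ 2) * v.2) / 2 * v.2 := by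
      simp only [hessianForm]
      ring
    rw [hval]
    exact this

lemma continuousAt_line (z v : ℝ × ℝ) : Tendsto (fun s : ℝ => z + s • v) (𝓝 0) (𝓝 z) := by
  have hc : Continuous (fun s : ℝ => z + s • v) := by fun_prop
  simpa using hc.tendsto 0

lemma not_isLocalMax_of_hessianForm_pos {p q e : ℝ} (he : e ^ 2 = 1) {z : ℝ × ℝ}
    (hz : z ∈ criticalPoints (pairPotential p q e)) (v : ℝ × ℝ) (hv : 0 < hessianForm p q e z v) :
    ¬ IsLocalMax (pairPotential p q e) z := by
  obtain ⟨g, h, h0, hg⟩ := exists_hasDerivAt_line he hz v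
  intro hm
  refine not_isLocalMax_of_hasDerivAt h h0 hg (half_pos hv) ?_
  filter_upwards [(continuousAt_line z v).eventually hm] with s hs
  simpa using hs

lemma not_isLocalMin_of_hessianForm_neg {p q e : ℝ} (he : e ^ 2 = 1) {z : ℝ × ℝ}
    (hz : z ∈ criticalPoints (pairPotential p q e)) (v : ℝ × ℝ) (hv : hessianForm p q e z v < 0) :
    ¬ IsLocalMin (pairPotential p q e) z := by
  obtain ⟨g, h, h0, hg⟩ := exists_hasDerivAt_line he hz v
  intro hm
  refine not_isLocalMin_of_hasDerivAt h h0 hg (by linarith) ?_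
  filter_upwards [(continuousAt_line z v).eventually hm] with s hs
  simpa using hs

lemma zero_mem_criticalPoints {p q e : ℝ} (he : e ^ 2 = 1) :
    (0, 0) ∈ criticalPoints (pairPotential p q e) :=
  (mem_criticalPoints_pairPotential he).2 ⟨zero_mem_square, by simp [artanh_zero]⟩

/-- The eigenvectors (1, e) and (1, −e) give the form the values 2(q − 1) and 2(p − 1). -/
lemma isInflectionPoint_zero {p q e : ℝ} (he : e ^ 2 = 1) (hp : p < 1) (hq : 1 < q) :
    IsInflectionPoint (pairPotential p q e) (0, 0) := by
  refine ⟨zero_mem_criticalPoints he,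
    not_isLocalMax_of_hessianForm_pos he (zero_mem_criticalPoints he) (1, e) ?_,
    not_isLocalMin_of_hessianForm_neg he (zero_mem_criticalPoints he) (1, -e) ?_⟩
  · simp only [hessianForm]
    norm_num
    nlinarith
  · simp only [hessianForm]
    norm_num
    nlinarith

/-- The directions (1, −1) and (1, 1) give the form the values 2(q − cosh² w) and 2(p − cosh² w); p
< cosh² w follows from w < sinh w. -/
lemma isInflectionPoint_minor {p q w : ℝ} (hw : 0 < w) (hp : w * cosh w = p * sinh w)
    (hq : cosh w ^ 2 < q)
    (hz : (tanh w, tanh w) ∈ criticalPoints (pairPotential p q (-1))) :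
    IsInflectionPoint (pairPotential p q (-1)) (tanh w, tanh w) := by
  have hsq : (1 : ℝ) / (1 - tanh w ^ 2) = cosh w ^ 2 := by rw [one_sub_tanh_sq, one_div_one_div]
  refine ⟨hz, not_isLocalMax_of_hessianForm_pos (by norm_num) hz (1, -1) ?_,
    not_isLocalMin_of_hessianForm_neg (by norm_num) hz (1, 1) ?_⟩
  · simp only [hessianForm]
    norm_num only [hsq]
    linarith
  · simp only [hessianForm]
    norm_num only [hsq]
    have h1 := self_lt_sinh_iff.2 hw
    have h2 := one_le_cosh w
    have h3 : p < cosh w ^ 2 := by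
      have : p * sinh w < cosh w ^ 2 * sinh w := by
        calc p * sinh w = w * cosh w := hp.symm
          _ < sinh w * cosh w := mul_lt_mul_of_pos_right h1 (cosh_pos w)
          _ ≤ cosh w ^ 2 * sinh w := by
            have := hw.trans h1
            nlinarith [mul_nonneg this.le (mul_nonneg (cosh_pos w).le (sub_nonneg.2 h2))]
      exact lt_of_mul_lt_mul_right this (hw.trans h1).le
    linarith

/-! ### Critical points off the diagonals -/

/-- The critical point equations in the variables `U = artanh x + artanh y` and
`V = artanh y - artanh x`, for the eigenvector `(1, -1)`. -/
def HyperbolicSystem (p q U V : ℝ) : Prop :=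
  U * (cosh U + cosh V) = 2 * p * sinh U ∧ V * (cosh U + cosh V) = 2 * q * sinh V

lemma cosh_mul_cosh_half (U V : ℝ) :
    2 * (cosh ((U - V) / 2) * cosh ((U + V) / 2)) = cosh U + cosh V := by
  have h1 := cosh_add ((U + V) / 2) ((U - V) / 2)
  have h2 := cosh_sub ((U + V) / 2) ((U - V) / 2)
  rw [show (U + V) / 2 + (U - V) / 2 = U by ring] at h1
  rw [show (U + V) / 2 - (U - V) / 2 = V by ring] at h2
  rw [h1, h2]
  ring

lemma tanh_add_tanh_half (U V : ℝ) :
    (tanh ((U - V) / 2) + tanh ((U + V) / 2)) * (cosh U + cosh V) = 2 * sinh U := by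
  have h1 := sinh_add ((U + V) / 2) ((U - V) / 2)
  rw [show (U + V) / 2 + (U - V) / 2 = U by ring] at h1
  rw [← cosh_mul_cosh_half, h1, tanh_eq_sinh_div_cosh, tanh_eq_sinh_div_cosh]
  have := cosh_pos ((U + V) / 2)
  have := cosh_pos ((U - V) / 2)
  field_simp
  ring

lemma tanh_sub_tanh_half (U V : ℝ) :
    (tanh ((U + V) / 2) - tanh ((U - V) / 2)) * (cosh U + cosh V) = 2 * sinh V := by
  have h1 := sinh_sub ((U + V) / 2) ((U - V) / 2)
  rw [show (U + V) / 2 - (U - V) / 2 = V by ring] at h1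
  rw [← cosh_mul_cosh_half, h1, tanh_eq_sinh_div_cosh, tanh_eq_sinh_div_cosh]
  have := cosh_pos ((U + V) / 2)
  have := cosh_pos ((U - V) / 2)
  field_simp

/-- Adding and subtracting the critical equations gives U = p(x + y) and V = q(y − x); the addition
formulas express x ± y through U and V. -/
lemma tanh_half_mem_criticalPoints {p q U V : ℝ} :
    (tanh ((U - V) / 2), tanh ((U + V) / 2)) ∈ criticalPoints (pairPotential p q (-1)) ↔
      HyperbolicSystem p q U V := by
  rw [mem_criticalPoints_pairPotential (by norm_num)]
  have h1 := tanh_add_tanh_half U V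
  have h2 := tanh_sub_tanh_half U V
  have hpos : 0 < cosh U + cosh V := add_pos (cosh_pos U) (cosh_pos V)
  have hm : (tanh ((U - V) / 2), tanh ((U + V) / 2)) ∈ square :=
    ⟨tanh_mem_Ioo _, tanh_mem_Ioo _⟩
  simp only [artanh_tanh, HyperbolicSystem, hm, true_and]
  set x := tanh ((U - V) / 2)
  set y := tanh ((U + V) / 2)
  constructor
  · rintro ⟨e1, e2⟩
    constructor
    · linear_combination (cosh U + cosh V) * (e1 + e2) + p * h1
    · linear_combination (cosh U + cosh V) * (e2 - e1) + q * h2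
  · rintro ⟨e1, e2⟩
    have d1 : U = p * (x + y) := mul_right_cancel₀ hpos.ne' (by linear_combination e1 - p * h1)
    have d2 : V = q * (y - x) := mul_right_cancel₀ hpos.ne' (by linear_combination e2 - q * h2)
    constructor <;> linarith

namespace HyperbolicSystem

variable {p q U V : ℝ}

lemma neg_left (h : HyperbolicSystem p q U V) : HyperbolicSystem p q (-U) V := by
  have h1 := h.1
  have h2 := h.2
  refine ⟨?_, ?_⟩ <;> simp only [cosh_neg, sinh_neg] <;> linarith

lemma neg_right (h : HyperbolicSystem p q U V) : HyperbolicSystem p q U (-V) := by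
  have h1 := h.1
  have h2 := h.2
  refine ⟨?_, ?_⟩ <;> simp only [cosh_neg, sinh_neg] <;> linarith

lemma abs_abs (h : HyperbolicSystem p q U V) : HyperbolicSystem p q |U| |V| := by
  rcases abs_choice U with hU | hU <;> rcases abs_choice V with hV | hV <;> rw [hU, hV]
  exacts [h, h.neg_right, h.neg_left, h.neg_left.neg_right]

lemma cosh_add_cosh_eq (h : HyperbolicSystem p q U V) (hU : 0 < U) :
    cosh U + cosh V = 2 * p * sinhc U := by
  have := h.1
  rw [← mul_sinhc U] at this
  exact mul_left_cancel₀ hU.ne' (by linarith)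

lemma cosh_add_cosh_eq' (h : HyperbolicSystem p q U V) (hV : 0 < V) :
    cosh U + cosh V = 2 * q * sinhc V := by
  have := h.2
  rw [← mul_sinhc V] at this
  exact mul_left_cancel₀ hV.ne' (by linarith)

lemma mul_sinhc_eq (h : HyperbolicSystem p q U V) (hU : 0 < U) (hV : 0 < V) :
    p * sinhc U = q * sinhc V := by
  linarith [h.cosh_add_cosh_eq hU, h.cosh_add_cosh_eq' hV]

lemma lt_of_lt (h : HyperbolicSystem p q U V) (hU : 0 < U) (hV : 0 < V) (hp : 0 < p)
    (hpq : p < q) : V < U := by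
  have h1 := h.mul_sinhc_eq hU hV
  rw [← strictMonoOn_sinhc.lt_iff_lt (mem_Ici.2 hV.le) (mem_Ici.2 hU.le)]
  nlinarith [sinhc_pos hV.le]

/-- Since U/sinh U = 2p/E and V/sinh V = 2q/E with E = cosh U + cosh V, the weights q and p make E
cancel. -/
lemma weighted_sum_eq (h : HyperbolicSystem p q U V) (hU : 0 < U) (hV : 0 < V) :
    q * (U * cosh U / sinh U) + p * (V * cosh V / sinh V) = 2 * p * q := by
  have h1 := h.1
  have h2 := h.2
  have hsU := sinh_pos_iff.2 hU
  have hsV := sinh_pos_iff.2 hV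
  have hE : 0 < cosh U + cosh V := add_pos (cosh_pos U) (cosh_pos V)
  have e1 : U / sinh U = 2 * p / (cosh U + cosh V) := by
    rw [div_eq_div_iff hsU.ne' hE.ne', h1]
  have e2 : V / sinh V = 2 * q / (cosh U + cosh V) := by
    rw [div_eq_div_iff hsV.ne' hE.ne', h2]
  rw [mul_div_right_comm U, mul_div_right_comm V, e1, e2]
  field_simp

/-- If U < U', then `mul_sinhc_eq` forces V < V', so the left side of `weighted_sum_eq` would
increase strictly while its right side is fixed. -/
theorem unique {U' V' : ℝ} (h : HyperbolicSystem p q U V) (h' : HyperbolicSystem p q U' V')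
    (hp : 0 < p) (hq : 0 < q) (hU : 0 < U) (hV : 0 < V) (hU' : 0 < U') (hV' : 0 < V') :
    U = U' ∧ V = V' := by
  have key : ∀ {U V U' V' : ℝ}, HyperbolicSystem p q U V → HyperbolicSystem p q U' V' →
      0 < U → 0 < V → 0 < U' → 0 < V' → ¬ U < U' := by
    intro U V U' V' h h' hU hV hU' hV' hlt
    have h1 := strictMonoOn_sinhc (mem_Ici.2 hU.le) (mem_Ici.2 hU'.le) hlt
    have h2 : V < V' := by
      rw [← strictMonoOn_sinhc.lt_iff_lt (mem_Ici.2 hV.le) (mem_Ici.2 hV'.le)]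
      have e1 := h.mul_sinhc_eq hU hV
      have e2 := h'.mul_sinhc_eq hU' hV'
      nlinarith
    have k1 := strictMonoOn_mul_cosh_div_sinh hU hU' hlt
    have k2 := strictMonoOn_mul_cosh_div_sinh hV hV' h2
    have s1 := h.weighted_sum_eq hU hV
    have s2 := h'.weighted_sum_eq hU' hV'
    have := mul_lt_mul_of_pos_left k1 hq
    have := mul_lt_mul_of_pos_left k2 hp
    linarith
  have e : U = U' := le_antisymm (not_lt.1 (key h' h hU' hV' hU hV))
    (not_lt.1 (key h h' hU hV hU' hV'))
  subst e
  refine ⟨rfl, strictMonoOn_sinhc.injOn (mem_Ici.2 hV.le) (mem_Ici.2 hV'.le) ?_⟩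
  have e1 := h.mul_sinhc_eq hU hV
  have e2 := h'.mul_sinhc_eq hU hV'
  exact mul_left_cancel₀ hq.ne' (by linarith)

/-- Solutions off the diagonals exist only beyond the threshold. -/
theorem lt_cosh_sq {w : ℝ} (h : HyperbolicSystem p q U V) (hU : 0 < U) (hV : 0 < V) (hp : 0 < p)
    (hw : 0 < w) (hpw : w * cosh w = p * sinh w) : q < cosh w ^ 2 := by
  have hs := sinh_pos_iff.2 hw
  have h1 := h.cosh_add_cosh_eq hU
  have hu : 0 < U / 2 := half_pos hU
  -- As cosh V > 1, the first equation gives 2 cosh²(U/2) = 1 + cosh U < 2p sinhc U, that is, u coth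
  -- u < p = w coth w at u = U/2.
  have h2 : U / 2 < w := by
    have hsu := sinh_pos_iff.2 hu
    rw [← strictMonoOn_mul_cosh_div_sinh.lt_iff_lt hu hw, hpw, mul_div_cancel_right₀ _ hs.ne',
      div_lt_iff₀ hsu]
    have h3 := sinhc_two_mul hu.ne'
    have h4 := cosh_two_mul (U / 2)
    rw [mul_div_cancel₀ _ (two_ne_zero)] at h3 h4
    have h5 := cosh_sq (U / 2)
    have h6 := one_lt_cosh.2 hV.ne'
    have hc := cosh_pos (U / 2)
    have h7 : cosh (U / 2) < p * sinh (U / 2) / (U / 2) := by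
      have : cosh (U / 2) * cosh (U / 2) < p * sinh (U / 2) / (U / 2) * cosh (U / 2) := by
        have : p * sinh (U / 2) / (U / 2) * cosh (U / 2) = p * sinhc U := by
          rw [h3]; ring
        rw [this]
        nlinarith
      exact lt_of_mul_lt_mul_right this hc.le
    rw [lt_div_iff₀ hu] at h7
    linarith
  have h3 : sinhc U < sinhc (2 * w) :=
    strictMonoOn_sinhc (mem_Ici.2 hU.le) (mem_Ici.2 (by linarith)) (by linarith)
  have h4 : p * sinhc (2 * w) = cosh w ^ 2 := mul_sinhc_two_mul_eq hw hpw
  have h5 := h.mul_sinhc_eq hU hV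
  rw [← h4]
  -- For q > 0 the chain is q < q sinhc V = p sinhc U < p sinhc(2w) = cosh² w; for q ≤ 0 the bound
  -- is immediate.
  have h6 : q < q * sinhc V ∨ q ≤ 0 := by
    rcases lt_or_ge 0 q with hq | hq
    · left
      nlinarith [one_lt_sinhc hV]
    · exact Or.inr hq
  have h7 := mul_lt_mul_of_pos_left h3 hp
  rcases h6 with h6 | h6
  · linarith
  · have := mul_pos hp (sinhc_pos hU.le)
    linarith

end HyperbolicSystem

theorem exists_hyperbolicSystem {p q w : ℝ} (hpq : p < q) (hw : 0 < w)
    (hpw : w * cosh w = p * sinh w) (hq : q < cosh w ^ 2) :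
    ∃ U V, 0 < U ∧ 0 < V ∧ HyperbolicSystem p q U V := by
  have hs := sinh_pos_iff.2 hw
  -- The first equation forces cosh V = c(U). On [w, 2w] one has c ≥ 1, with V = w at U = w and V =
  -- 0 at U = 2w.
  set c : ℝ → ℝ := fun U => 2 * p * sinhc U - cosh U with hc
  have hcc : Continuous c := (continuous_sinhc.const_mul (2 * p)).sub continuous_cosh
  have hcU : ∀ u, 0 < u → c (2 * u) - 1 = 2 * cosh u / u * (p * sinh u - u * cosh u) := by
    intro u hu
    simp only [hc]
    rw [sinhc_two_mul hu.ne', cosh_two_mul, sinh_sq]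
    field_simp
    ring
  have hlt : ∀ u, 0 < u → u < w → 1 < c (2 * u) := by
    intro u hu huw
    have h1 := strictMonoOn_mul_cosh_div_sinh hu hw huw
    simp only at h1
    rw [hpw, mul_div_cancel_right₀ _ hs.ne', div_lt_iff₀ (sinh_pos_iff.2 hu)] at h1
    rw [← sub_pos, hcU u hu]
    have := cosh_pos u
    exact mul_pos (by positivity) (by linarith)
  have hcw : c w = cosh w := by
    simp only [hc]
    rw [sinhc_of_ne hw.ne', mul_div_assoc', mul_assoc, ← hpw]
    field_simp
    ring
  have hc2w : c (2 * w) = 1 := by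
    rw [← sub_eq_zero, hcU w hw, hpw, sub_self, mul_zero]
  have h2w : p * sinhc (2 * w) = cosh w ^ 2 := mul_sinhc_two_mul_eq hw hpw
  -- R is the defect in p sinhc U = q sinhc V along this curve. Its end values are (q − p) sinhc w >
  -- 0 and q − cosh² w < 0, so it has a zero with U < 2w, hence V > 0.
  set R : ℝ → ℝ := fun U => q * sinhc (arcosh (c U)) - p * sinhc U with hR
  have hRc : ContinuousOn R (Icc w (2 * w)) := by
    refine ((continuous_sinhc.comp_continuousOn (continuousOn_arcosh.comp hcc.continuousOn
      ?_)).const_smul q).sub (continuous_sinhc.continuousOn.const_smul p)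
    intro U hU
    rcases hU.2.eq_or_lt with h | h
    · rw [h, mem_Ici, hc2w]
    · have := hlt (U / 2) (by linarith [hU.1]) (by linarith)
      rw [mul_div_cancel₀ _ two_ne_zero] at this
      exact this.le
  have hRw : 0 < R w := by
    simp only [hR]
    rw [hcw, arcosh_cosh hw.le, ← sub_mul]
    exact mul_pos (sub_pos.2 hpq) (sinhc_pos hw.le)
  have hR2w : R (2 * w) < 0 := by
    simp only [hR]
    rw [hc2w, arcosh_zero, sinhc_zero, h2w]
    linarith
  obtain ⟨U, hU, hRU⟩ := intermediate_value_Icc' (by linarith : w ≤ 2 * w) hRc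
    (mem_Icc.2 ⟨hR2w.le, hRw.le⟩)
  have hU0 : 0 < U := hw.trans_le hU.1
  have hU2 : U < 2 * w := by
    refine lt_of_le_of_ne hU.2 ?_
    rintro rfl
    exact hR2w.ne hRU
  have h1 : 1 < c U := by
    have := hlt (U / 2) (by linarith) (by linarith)
    rwa [mul_div_cancel₀ _ two_ne_zero] at this
  have hsum : cosh U + cosh (arcosh (c U)) = 2 * p * sinhc U := by
    rw [cosh_arcosh h1.le]
    simp only [hc]
    ring
  refine ⟨U, arcosh (c U), hU0, arcosh_pos h1, ?_, ?_⟩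
  · rw [hsum, ← mul_sinhc U]
    ring
  · simp only [hR] at hRU
    rw [hsum, ← mul_sinhc (arcosh (c U))]
    linear_combination -2 * arcosh (c U) * hRU

/-- A symmetric `2 × 2` form of negative determinant takes positive values. -/
lemma exists_form_pos {a b d : ℝ} (h : a * d < b ^ 2) :
    ∃ x y : ℝ, 0 < a * x ^ 2 + 2 * b * x * y + d * y ^ 2 := by
  rcases lt_trichotomy a 0 with ha | ha | ha
  -- The form takes the value a(ad − b²) here, a product of two negative numbers.
  · refine ⟨-b, a, ?_⟩
    nlinarith
  · subst ha
    refine ⟨1 + |d|, b, ?_⟩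
    have hb : 0 < b ^ 2 := by simpa using h
    have h1 := neg_abs_le d
    have h2 := abs_nonneg d
    nlinarith [mul_pos hb (by linarith : 0 < 2 + 2 * |d| + d)]
  · exact ⟨1, 0, by simpa using ha⟩

/-- The Hessian determinant is negative. With a = U/sinh U, b = V/sinh V, X = cosh U, Y = cosh V, it
equals −(X + Y)/4 · ((aX − 1)(Y − b) + (bY − 1)(X − a)), and every factor is positive because a, b <
1 < X, Y and u coth u > 1. -/
theorem HyperbolicSystem.exists_hessianForm_pos {p q U V : ℝ} (h : HyperbolicSystem p q U V)
    (hU : 0 < U) (hV : 0 < V) :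
    ∃ v, 0 < hessianForm p q (-1) (tanh ((U - V) / 2), tanh ((U + V) / 2)) v := by
  set C := cosh ((U - V) / 2) ^ 2 with hC
  set D := cosh ((U + V) / 2) ^ 2 with hD
  have hform : ∀ x y : ℝ,
      hessianForm p q (-1) (tanh ((U - V) / 2), tanh ((U + V) / 2)) (x, y) =
        ((p + q) / 2 - C) * x ^ 2 + 2 * (-((q - p) / 2)) * x * y + ((p + q) / 2 - D) * y ^ 2 := by
    intro x y
    simp only [hessianForm, one_sub_tanh_sq, div_div_eq_mul_div, div_one, ← hC, ← hD]
    ring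
  suffices hdet : ((p + q) / 2 - C) * ((p + q) / 2 - D) < (-((q - p) / 2)) ^ 2 by
    obtain ⟨x, y, hxy⟩ := exists_form_pos hdet
    exact ⟨(x, y), by rwa [hform]⟩
  have hsU := sinh_pos_iff.2 hU
  have hsV := sinh_pos_iff.2 hV
  set X := cosh U with hX
  set Y := cosh V with hY
  have hX1 : 1 < X := one_lt_cosh.2 hU.ne'
  have hY1 : 1 < Y := one_lt_cosh.2 hV.ne'
  obtain ⟨a, ha⟩ : ∃ a, a = U / sinh U := ⟨_, rfl⟩
  obtain ⟨b, hb⟩ : ∃ b, b = V / sinh V := ⟨_, rfl⟩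
  have ha1 : a < 1 := by rw [ha, div_lt_one hsU]; exact self_lt_sinh_iff.2 hU
  have hb1 : b < 1 := by rw [hb, div_lt_one hsV]; exact self_lt_sinh_iff.2 hV
  have haX : 1 < a * X := by rw [ha, div_mul_eq_mul_div]; exact one_lt_mul_cosh_div_sinh hU
  have hbY : 1 < b * Y := by rw [hb, div_mul_eq_mul_div]; exact one_lt_mul_cosh_div_sinh hV
  have hp : p = a * (X + Y) / 2 := by
    have := h.1
    rw [ha]
    field_simp
    linarith
  have hq : q = b * (X + Y) / 2 := by
    have := h.2
    rw [hb]
    field_simp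
    linarith
  have hCD : C * D = ((X + Y) / 2) ^ 2 := by
    rw [hC, hD, ← mul_pow, hX, hY, ← cosh_mul_cosh_half]
    ring
  have hsum : C + D = 1 + X * Y := by
    have h1 := cosh_add ((U + V) / 2) ((U - V) / 2)
    have h2 := cosh_sub ((U + V) / 2) ((U - V) / 2)
    rw [show (U + V) / 2 + (U - V) / 2 = U by ring] at h1
    rw [show (U + V) / 2 - (U - V) / 2 = V by ring] at h2
    rw [hX, hY, h1, h2, hC, hD]
    have s1 := cosh_sq ((U + V) / 2)
    have s2 := cosh_sq ((U - V) / 2)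
    linear_combination (-sinh ((U - V) / 2) ^ 2) * s1 + (1 - cosh ((U + V) / 2) ^ 2) * s2
  have hpos : 0 < (X + Y) / 4 * ((a * X - 1) * (Y - b) + (b * Y - 1) * (X - a)) := by
    have := mul_pos (sub_pos.2 haX) (sub_pos.2 (hb1.trans hY1))
    have := mul_pos (sub_pos.2 hbY) (sub_pos.2 (ha1.trans hX1))
    have : 0 < X + Y := by linarith
    positivity
  have : ((p + q) / 2 - C) * ((p + q) / 2 - D) - (-((q - p) / 2)) ^ 2 =
      -((X + Y) / 4 * ((a * X - 1) * (Y - b) + (b * Y - 1) * (X - a))) := by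
    rw [hp, hq]
    linear_combination hCD - (a * (X + Y) / 2 + b * (X + Y) / 2) / 2 * hsum
  linarith

/-! ### Classification of the critical points -/

section Classification

variable {p q e : ℝ}

lemma artanh_sign_mul (he : e ^ 2 = 1) {y : ℝ} (hy : y ∈ Ioo (-1 : ℝ) 1) :
    artanh (e * y) = e * artanh y := by
  rcases mul_self_eq_one_iff.1 ((sq e).symm.trans he) with rfl | rfl
  · simp
  · simp [artanh_odd hy]

lemma sign_mul_mem_Ioo (he : e ^ 2 = 1) {y : ℝ} (hy : y ∈ Ioo (-1 : ℝ) 1) :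
    e * y ∈ Ioo (-1 : ℝ) 1 := by
  rcases mul_self_eq_one_iff.1 ((sq e).symm.trans he) with rfl | rfl
  · simpa using hy
  · constructor <;> linarith [hy.1, hy.2]

lemma major_mem_criticalPoints (he : e ^ 2 = 1) {x : ℝ} (hx : x ∈ Ioo (-1 : ℝ) 1)
    (h : artanh x = q * x) : (x, e * x) ∈ criticalPoints (pairPotential p q e) := by
  refine (mem_criticalPoints_pairPotential he).2 ⟨⟨hx, sign_mul_mem_Ioo he hx⟩, ?_, ?_⟩
  · simp only [h]
    linear_combination -(q - p) / 2 * x * he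
  · simp only [artanh_sign_mul he hx, h]
    ring

lemma minor_mem_criticalPoints {x : ℝ} (hx : x ∈ Ioo (-1 : ℝ) 1) (h : artanh x = p * x) :
    (x, x) ∈ criticalPoints (pairPotential p q (-1)) := by
  refine (mem_criticalPoints_pairPotential (by norm_num)).2 ⟨⟨hx, hx⟩, ?_, ?_⟩ <;>
  · simp only [h]
    ring

/-- Below the critical temperature of the minor eigenvalue, all critical points lie on the
diagonal of the major eigenvector. -/
lemma eq_of_mem_criticalPoints_of_lt_one (he : e ^ 2 = 1) (hp : p < 1) {z : ℝ × ℝ}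
    (hz : z ∈ criticalPoints (pairPotential p q e)) :
    z.2 = e * z.1 ∧ artanh z.1 = q * z.1 := by
  obtain ⟨⟨hx, hy⟩, h1, h2⟩ := (mem_criticalPoints_pairPotential he).1 hz
  have hy' := sign_mul_mem_Ioo he hy
  have hA := artanh_sign_mul he hy
  -- The combination along (1, −e) decouples with coefficient p < 1, too small for the growth of
  -- artanh unless z.1 = e z.2.
  have hd : artanh z.1 - artanh (e * z.2) = p * (z.1 - e * z.2) := by
    rw [hA, h1, h2]
    linear_combination -(q - p) / 2 * z.1 * he
  have heq : z.1 = e * z.2 := by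
    rcases lt_trichotomy z.1 (e * z.2) with h | h | h
    · have := strictMonoOn_artanh_sub hx hy' h
      simp only at this
      nlinarith
    · exact h
    · have := strictMonoOn_artanh_sub hy' hx h
      simp only at this
      nlinarith
  refine ⟨by rw [heq]; linear_combination -z.2 * he, ?_⟩
  rw [h1]
  linear_combination -(q - p) / 2 * heq

theorem criticalPoints_eq_singleton (he : e ^ 2 = 1) (hpq : p < q) (hq : q ≤ 1) :
    criticalPoints (pairPotential p q e) = {(0, 0)} := by
  ext z
  rw [mem_singleton_iff]
  constructor
  · intro hz
    obtain ⟨h1, h2⟩ := eq_of_mem_criticalPoints_of_lt_one he (hpq.trans_le hq) hz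
    have hx := hz.1
    have h0 : z.1 = 0 := by
      rcases lt_trichotomy z.1 0 with h | h | h
      · have := self_lt_artanh (x := -z.1) ⟨by linarith, by linarith [hx.1]⟩
        rw [artanh_odd hx] at this
        nlinarith
      · exact h
      · have := self_lt_artanh ⟨h, hx.2⟩
        nlinarith
    rw [h0, mul_zero] at h1
    exact Prod.ext h0 h1
  · rintro rfl
    exact zero_mem_criticalPoints he

theorem criticalPoints_eq_three (he : e ^ 2 = 1) (hp : p < 1) {w : ℝ} (hw : 0 < w)
    (hqw : w * cosh w = q * sinh w) :
    criticalPoints (pairPotential p q e) =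
      {(0, 0), (tanh w, e * tanh w), (-tanh w, -(e * tanh w))} := by
  ext z
  simp only [mem_insert_iff, mem_singleton_iff]
  constructor
  · intro hz
    obtain ⟨h1, h2⟩ := eq_of_mem_criticalPoints_of_lt_one he hp hz
    rcases (artanh_eq_mul_iff hw hqw hz.1).1 h2 with h | h | h
    · exact Or.inl (Prod.ext h (by simp [h1, h]))
    · exact Or.inr (Or.inl (Prod.ext h (by simp [h1, h])))
    · exact Or.inr (Or.inr (Prod.ext h (by simp [h1, h])))
  · rintro (rfl | rfl | rfl)
    · exact zero_mem_criticalPoints he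
    · exact major_mem_criticalPoints he (tanh_mem_Ioo w) (artanh_tanh_eq_mul hqw)
    · rw [← mul_neg, ← tanh_neg]
      refine major_mem_criticalPoints he (tanh_mem_Ioo (-w)) ?_
      rw [artanh_tanh, tanh_neg, mul_neg, ← artanh_tanh_eq_mul hqw, artanh_tanh]

/-- A critical point lies on one of the diagonals or solves the hyperbolic system. -/
lemma mem_criticalPoints_cases {w w' : ℝ} (hw : 0 < w) (hqw : w * cosh w = q * sinh w)
    (hw' : 0 < w') (hpw : w' * cosh w' = p * sinh w') {z : ℝ × ℝ}
    (hz : z ∈ criticalPoints (pairPotential p q (-1))) :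
    z ∈ ({(0, 0), (tanh w, -tanh w), (-tanh w, tanh w), (tanh w', tanh w'),
      (-tanh w', -tanh w')} : Set (ℝ × ℝ)) ∨
    ∃ U V, U ≠ 0 ∧ V ≠ 0 ∧ HyperbolicSystem p q U V ∧
      z = (tanh ((U - V) / 2), tanh ((U + V) / 2)) := by
  have hx := hz.1
  have hy := hz.2.1
  obtain ⟨-, h1, h2⟩ := (mem_criticalPoints_pairPotential (by norm_num)).1 hz
  simp only [mem_insert_iff, mem_singleton_iff, Prod.ext_iff]
  rcases eq_or_ne (artanh z.1 + artanh z.2) 0 with hU | hU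
  · have h3 : z.2 = -z.1 := by
      apply artanh_injOn hy (by constructor <;> linarith [hx.1, hx.2])
      rw [artanh_odd hx]
      linarith
    rw [h3] at h1
    have h4 : artanh z.1 = q * z.1 := by linarith
    left
    rcases (artanh_eq_mul_iff hw hqw hx).1 h4 with h | h | h <;> simp [h3, h]
  rcases eq_or_ne (artanh z.2 - artanh z.1) 0 with hV | hV
  · have h3 : z.2 = z.1 := artanh_injOn hy hx (by linarith)
    rw [h3] at h1
    have h4 : artanh z.1 = p * z.1 := by linarith
    left
    rcases (artanh_eq_mul_iff hw' hpw hx).1 h4 with h | h | h <;> simp [h3, h]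
  · right
    have e1 : z = (tanh ((artanh z.1 + artanh z.2 - (artanh z.2 - artanh z.1)) / 2),
        tanh ((artanh z.1 + artanh z.2 + (artanh z.2 - artanh z.1)) / 2)) := by
      rw [show (artanh z.1 + artanh z.2 - (artanh z.2 - artanh z.1)) / 2 = artanh z.1 by ring,
        show (artanh z.1 + artanh z.2 + (artanh z.2 - artanh z.1)) / 2 = artanh z.2 by ring,
        tanh_artanh hx, tanh_artanh hy]
    refine ⟨_, _, hU, hV, ?_, Prod.ext_iff.1 e1⟩
    rw [← tanh_half_mem_criticalPoints, ← e1]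
    exact hz

lemma diagonal_mem_criticalPoints {w w' : ℝ} (hqw : w * cosh w = q * sinh w)
    (hpw : w' * cosh w' = p * sinh w') {z : ℝ × ℝ}
    (hz : z ∈ ({(0, 0), (tanh w, -tanh w), (-tanh w, tanh w), (tanh w', tanh w'),
      (-tanh w', -tanh w')} : Set (ℝ × ℝ))) :
    z ∈ criticalPoints (pairPotential p q (-1)) := by
  have hneg : ∀ {c u : ℝ}, u * cosh u = c * sinh u → artanh (-tanh u) = c * -tanh u := by
    intro c u h
    rw [artanh_odd (tanh_mem_Ioo u), artanh_tanh_eq_mul h, mul_neg]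
  have hmem : ∀ u, -tanh u ∈ Ioo (-1 : ℝ) 1 := fun u => by
    rw [← tanh_neg]; exact tanh_mem_Ioo (-u)
  simp only [mem_insert_iff, mem_singleton_iff] at hz
  rcases hz with rfl | rfl | rfl | rfl | rfl
  · exact zero_mem_criticalPoints (by norm_num)
  · simpa using major_mem_criticalPoints (p := p) (e := -1) (by norm_num) (tanh_mem_Ioo w)
      (artanh_tanh_eq_mul hqw)
  · simpa using major_mem_criticalPoints (p := p) (e := -1) (by norm_num) (hmem w) (hneg hqw)
  · exact minor_mem_criticalPoints (tanh_mem_Ioo w') (artanh_tanh_eq_mul hpw)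
  · exact minor_mem_criticalPoints (hmem w') (hneg hpw)

theorem criticalPoints_eq_five {w w' : ℝ} (hw : 0 < w) (hqw : w * cosh w = q * sinh w)
    (hw' : 0 < w') (hpw : w' * cosh w' = p * sinh w') (hp : 0 < p) (hq : cosh w' ^ 2 < q) :
    criticalPoints (pairPotential p q (-1)) =
      {(0, 0), (tanh w, -tanh w), (-tanh w, tanh w), (tanh w', tanh w'),
        (-tanh w', -tanh w')} := by
  ext z
  refine ⟨fun hz => ?_, diagonal_mem_criticalPoints hqw hpw⟩
  rcases mem_criticalPoints_cases hw hqw hw' hpw hz with h | ⟨U, V, hU, hV, h, -⟩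
  · exact h
  · exact absurd (h.abs_abs.lt_cosh_sq (abs_pos.2 hU) (abs_pos.2 hV) hp hw' hpw) hq.not_gt

theorem criticalPoints_eq_nine {w w' U V : ℝ} (hw : 0 < w) (hqw : w * cosh w = q * sinh w)
    (hw' : 0 < w') (hpw : w' * cosh w' = p * sinh w') (hp : 0 < p) (hq : 0 < q) (hU : 0 < U)
    (hV : 0 < V) (h : HyperbolicSystem p q U V) :
    criticalPoints (pairPotential p q (-1)) =
      {(0, 0), (tanh w, -tanh w), (-tanh w, tanh w), (tanh w', tanh w'), (-tanh w', -tanh w'),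
        (tanh ((U - V) / 2), tanh ((U + V) / 2)), (-tanh ((U - V) / 2), -tanh ((U + V) / 2)),
        (tanh ((U + V) / 2), tanh ((U - V) / 2)), (-tanh ((U + V) / 2), -tanh ((U - V) / 2))} := by
  -- Sign changes of (U, V) permute the four points: negating both negates the point, negating V
  -- swaps its coordinates.
  have e1 : -tanh ((U - V) / 2) = tanh ((-U - -V) / 2) := by rw [← tanh_neg]; congr 1; ring
  have e2 : -tanh ((U + V) / 2) = tanh ((-U + -V) / 2) := by rw [← tanh_neg]; congr 1; ring
  have e3 : tanh ((U + V) / 2) = tanh ((U - -V) / 2) := by congr 1; ring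
  have e4 : tanh ((U - V) / 2) = tanh ((U + -V) / 2) := by congr 1
  have e5 : -tanh ((U + V) / 2) = tanh ((-U - V) / 2) := by rw [← tanh_neg]; congr 1; ring
  have e6 : -tanh ((U - V) / 2) = tanh ((-U + V) / 2) := by rw [← tanh_neg]; congr 1; ring
  ext z
  constructor
  · intro hz
    rcases mem_criticalPoints_cases hw hqw hw' hpw hz with h' | ⟨U', V', hU', hV', h', rfl⟩
    · simp only [mem_insert_iff, mem_singleton_iff] at h' ⊢
      tauto
    · obtain ⟨k1, k2⟩ := h'.abs_abs.unique h hp hq (abs_pos.2 hU') (abs_pos.2 hV') hU hV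
      simp only [mem_insert_iff, mem_singleton_iff]
      rcases eq_or_eq_neg_of_abs_eq k1 with r1 | r1 <;>
        rcases eq_or_eq_neg_of_abs_eq k2 with r2 | r2 <;> rw [r1, r2]
      · tauto
      · rw [← e3, ← e4]
        tauto
      · rw [← e5, ← e6]
        tauto
      · rw [← e1, ← e2]
        tauto
  · intro hz
    by_cases hd : z ∈ ({(0, 0), (tanh w, -tanh w), (-tanh w, tanh w), (tanh w', tanh w'),
      (-tanh w', -tanh w')} : Set (ℝ × ℝ))
    · exact diagonal_mem_criticalPoints hqw hpw hd
    · simp only [mem_insert_iff, mem_singleton_iff] at hd hz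
      have : z = (tanh ((U - V) / 2), tanh ((U + V) / 2)) ∨
          z = (-tanh ((U - V) / 2), -tanh ((U + V) / 2)) ∨
          z = (tanh ((U + V) / 2), tanh ((U - V) / 2)) ∨
          z = (-tanh ((U + V) / 2), -tanh ((U - V) / 2)) := by tauto
      rcases this with rfl | rfl | rfl | rfl
      · exact tanh_half_mem_criticalPoints.2 h
      · rw [e1, e2]
        exact tanh_half_mem_criticalPoints.2 h.neg_left.neg_right
      · rw [e3, e4]
        exact tanh_half_mem_criticalPoints.2 h.neg_right
      · rw [e5, e6]
        exact tanh_half_mem_criticalPoints.2 h.neg_left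

end Classification

/-! ### Cardinalities -/

lemma ncard_three {x y : ℝ} (hx : 0 < x) :
    ({(0, 0), (x, y), (-x, -y)} : Set (ℝ × ℝ)).ncard = 3 := by
  rw [ncard_insert_of_notMem, ncard_pair]
  · simp only [ne_eq, Prod.mk.injEq, not_and]
    intro h
    linarith
  · simp only [mem_insert_iff, mem_singleton_iff, Prod.mk.injEq, not_or, not_and]
    constructor <;> intro h <;> linarith

lemma ncard_five {x y : ℝ} (hx : 0 < x) (hy : 0 < y) :
    ({(0, 0), (x, -x), (-x, x), (y, y), (-y, -y)} : Set (ℝ × ℝ)).ncard = 5 := by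
  have h : ({(0, 0), (x, -x), (-x, x), (y, y), (-y, -y)} : Set (ℝ × ℝ)) =
      ↑({(0, 0), (x, -x), (-x, x), (y, y), (-y, -y)} : Finset (ℝ × ℝ)) := by simp
  rw [h, ncard_coe_finset]
  repeat rw [Finset.card_insert_of_notMem (by
    simp only [Finset.mem_insert, Finset.mem_singleton, Prod.mk.injEq]; grind)]
  rw [Finset.card_singleton]

lemma ncard_nine {x y a b : ℝ} (hx : 0 < x) (hy : 0 < y) (ha : 0 < a) (hab : a < b) :
    ({(0, 0), (x, -x), (-x, x), (y, y), (-y, -y), (a, b), (-a, -b), (b, a), (-b, -a)} :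
      Set (ℝ × ℝ)).ncard = 9 := by
  have h : ({(0, 0), (x, -x), (-x, x), (y, y), (-y, -y), (a, b), (-a, -b), (b, a), (-b, -a)} :
      Set (ℝ × ℝ)) = ↑({(0, 0), (x, -x), (-x, x), (y, y), (-y, -y), (a, b), (-a, -b), (b, a),
        (-b, -a)} : Finset (ℝ × ℝ)) := by simp
  rw [h, ncard_coe_finset]
  repeat rw [Finset.card_insert_of_notMem (by
    simp only [Finset.mem_insert, Finset.mem_singleton, Prod.mk.injEq]; grind)]
  rw [Finset.card_singleton]

/-! ### The threshold -/

/-- The substitution √(1 − s) = tanh w turns the left side of the threshold equation into w/(sinh w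
cosh w) = 1/sinhc(2w), a monotone function of w. -/
lemma isThreshold_iff {lM lm s : ℝ} :
    IsThreshold lM lm s ↔ ∃ w, 0 < w ∧ s = 1 / cosh w ^ 2 ∧ 1 / sinhc (2 * w) = lm / lM := by
  have hval : ∀ w, 0 < w → 1 / sinhc (2 * w) = 1 / cosh w ^ 2 * w / tanh w := by
    intro w hw
    have := sinh_pos_iff.2 hw
    have := cosh_pos w
    rw [sinhc_two_mul hw.ne', tanh_eq_sinh_div_cosh]
    field_simp
  constructor
  · rintro ⟨h0, h1, h⟩
    have hr0 : 0 < √(1 - s) := Real.sqrt_pos.2 (by linarith)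
    have hr1 : √(1 - s) < 1 := (Real.sqrt_lt' one_pos).2 (by linarith)
    have hw : 0 < artanh √(1 - s) := artanh_pos ⟨hr0, hr1⟩
    have ht : tanh (artanh √(1 - s)) = √(1 - s) := tanh_artanh ⟨by linarith, hr1⟩
    have hs : s = 1 / cosh (artanh √(1 - s)) ^ 2 := by
      rw [← one_sub_tanh_sq, ht, Real.sq_sqrt (by linarith)]
      ring
    refine ⟨_, hw, hs, ?_⟩
    rw [hval _ hw, ← hs, ht, h]
  · rintro ⟨w, hw, rfl, h⟩
    have hc : 1 < cosh w := one_lt_cosh.2 hw.ne'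
    have hr : √(1 - 1 / cosh w ^ 2) = tanh w := by
      rw [← one_sub_tanh_sq, sub_sub_cancel, Real.sqrt_sq (tanh_pos hw).le]
    refine ⟨by positivity, ?_, ?_⟩
    · rw [div_lt_one (by positivity)]
      nlinarith
    · rw [hr, artanh_tanh, ← hval w hw, h]

lemma existsUnique_isThreshold {lM lm : ℝ} (hm : 0 < lm) (hmM : lm < lM) :
    ∃! s, IsThreshold lM lm s := by
  obtain ⟨U, hU, hUR⟩ := exists_sinhc_eq ((one_lt_div hm).2 hmM)
  refine ⟨1 / cosh (U / 2) ^ 2, isThreshold_iff.2 ⟨U / 2, half_pos hU, rfl, ?_⟩, ?_⟩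
  · rw [mul_div_cancel₀ _ two_ne_zero, hUR, one_div_div]
  · intro s hs
    obtain ⟨w, hw, rfl, h⟩ := isThreshold_iff.1 hs
    have : 2 * w = U := by
      apply strictMonoOn_sinhc.injOn (mem_Ici.2 (by linarith)) (mem_Ici.2 hU.le)
      rw [hUR, ← one_div_one_div (sinhc (2 * w)), h, one_div_div]
    rw [← this, mul_div_cancel_left₀ _ two_ne_zero]

section ThresholdComparison

variable {p w w₀ : ℝ}

/-- After the double-angle formula the left inequality is p < w₀ coth w₀. It translates the
condition on β, where q = p sinhc(2w₀), into a comparison of w with w₀. -/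
lemma mul_sinhc_two_mul_lt_iff (hw : 0 < w) (hpw : w * cosh w = p * sinh w) (hw₀ : 0 < w₀) :
    p * sinhc (2 * w₀) < cosh w₀ ^ 2 ↔ w < w₀ := by
  have hs := sinh_pos_iff.2 hw₀
  rw [← strictMonoOn_mul_cosh_div_sinh.lt_iff_lt hw hw₀, hpw,
    mul_div_cancel_right₀ _ (sinh_pos_iff.2 hw).ne', lt_div_iff₀ hs, sinhc_two_mul hw₀.ne',
    ← mul_div_assoc, div_lt_iff₀ hw₀,
    show p * (sinh w₀ * cosh w₀) = (p * sinh w₀) * cosh w₀ by ring,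
    show cosh w₀ ^ 2 * w₀ = (w₀ * cosh w₀) * cosh w₀ by ring, mul_lt_mul_iff_left₀ (cosh_pos w₀)]

lemma lt_mul_sinhc_two_mul_iff (hw : 0 < w) (hpw : w * cosh w = p * sinh w) (hw₀ : 0 < w₀) :
    cosh w₀ ^ 2 < p * sinhc (2 * w₀) ↔ w₀ < w := by
  have hs := sinh_pos_iff.2 hw₀
  rw [← strictMonoOn_mul_cosh_div_sinh.lt_iff_lt hw₀ hw, hpw,
    mul_div_cancel_right₀ _ (sinh_pos_iff.2 hw).ne', div_lt_iff₀ hs, sinhc_two_mul hw₀.ne',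
    ← mul_div_assoc, lt_div_iff₀ hw₀,
    show p * (sinh w₀ * cosh w₀) = (p * sinh w₀) * cosh w₀ by ring,
    show cosh w₀ ^ 2 * w₀ = (w₀ * cosh w₀) * cosh w₀ by ring, mul_lt_mul_iff_left₀ (cosh_pos w₀)]

end ThresholdComparison

/-! ### The reduced model -/

lemma eigenvalueSet_eq (a b : ℝ) : eigenvalueSet a b a = {a + b, a - b} := by
  ext l
  simp only [eigenvalueSet, mem_ofPred_eq, mem_insert_iff, mem_singleton_iff]
  constructor
  · intro h
    obtain ⟨v, hv⟩ := h.exists_hasEigenvector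
    have h1 := congrFun hv.apply_eq_smul 0
    have h2 := congrFun hv.apply_eq_smul 1
    simp [reducedMatrix, Matrix.mulVec, dotProduct, Fin.sum_univ_two] at h1 h2
    by_contra! hl
    have d1 : (l - (a + b)) * (v 0 + v 1) = 0 := by linear_combination -h1 - h2
    have d2 : (l - (a - b)) * (v 0 - v 1) = 0 := by linear_combination -h1 + h2
    have e1 := (mul_eq_zero.1 d1).resolve_left (sub_ne_zero.2 hl.1)
    have e2 := (mul_eq_zero.1 d2).resolve_left (sub_ne_zero.2 hl.2)
    apply hv.2
    ext i
    fin_cases i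
    · simp; linarith
    · simp; linarith
  · rintro (rfl | rfl)
    · refine Module.End.hasEigenvalue_of_hasEigenvector (x := ![1, 1])
        ⟨Module.End.mem_eigenspace_iff.2 ?_, fun h => by simpa using congrFun h 0⟩
      ext i
      fin_cases i
      · simp [reducedMatrix, Matrix.mulVec, dotProduct, Fin.sum_univ_two]
      · simp [reducedMatrix, Matrix.mulVec, dotProduct, Fin.sum_univ_two, add_comm]
    · refine Module.End.hasEigenvalue_of_hasEigenvector (x := ![1, -1])
        ⟨Module.End.mem_eigenspace_iff.2 ?_, fun h => by simpa using congrFun h 0⟩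
      ext i
      fin_cases i
      · simp [reducedMatrix, Matrix.mulVec, dotProduct, Fin.sum_univ_two, sub_eq_add_neg]
      · simp [reducedMatrix, Matrix.mulVec, dotProduct, Fin.sum_univ_two, sub_eq_add_neg]

lemma isGreatest_pair_iff {x y l : ℝ} (h : x < y) : IsGreatest {x, y} l ↔ l = y := by
  constructor
  · rintro ⟨h1, h2⟩
    have := h2 (mem_insert_of_mem x (mem_singleton y))
    rcases h1 with h1 | h1
    · linarith
    · exact h1
  · rintro rfl
    refine ⟨by simp, ?_⟩
    rintro z (rfl | rfl)
    · exact h.le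
    · exact le_rfl

lemma isLeast_pair_iff {x y l : ℝ} (h : x < y) : IsLeast {x, y} l ↔ l = x := by
  constructor
  · rintro ⟨h1, h2⟩
    have := h2 (mem_insert x {y})
    rcases h1 with h1 | h1
    · exact h1
    · rw [mem_singleton_iff] at h1
      linarith
  · rintro rfl
    refine ⟨by simp, ?_⟩
    rintro z (rfl | rfl)
    · exact le_rfl
    · exact h.le

/-- The vector (1, e) has eigenvalue a + e b; e is chosen later to make this the larger one. -/
lemma pressureFunctional_eq (β a b : ℝ) {e : ℝ} (he : e ^ 2 = 1) :
    pressureFunctional β (1 / 2) a b a 0 0 =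
      pairPotential (β * (a - e * b) / 2) (β * (a + e * b) / 2) e := by
  funext z
  simp only [pressureFunctional, energy, pairPotential, singlePotential]
  linear_combination (-(β * b * z.1 * z.2) / 4 + e * β * b * z.2 ^ 2 / 8) * he

lemma isPosSolution_tanh {β l w : ℝ} (hw : 0 < w) (h : w * cosh w = β * l / 2 * sinh w) :
    IsPosSolution β l (tanh w) := by
  refine ⟨tanh_pos hw, ?_⟩
  rw [← artanh_tanh_eq_mul h, artanh_tanh]

/-! ### The phases of the model -/

section Phases

variable {β lM lm : ℝ}

theorem unique_phase {e : ℝ} (he : e ^ 2 = 1) (hβ : 0 < β) (hl : lm < lM) (h : β * lM / 2 ≤ 1) :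
    criticalPoints (pairPotential (β * lm / 2) (β * lM / 2) e) = {(0, 0)} ∧
      IsLocalMax (pairPotential (β * lm / 2) (β * lM / 2) e) (0, 0) := by
  have hpq : β * lm / 2 < β * lM / 2 := by nlinarith
  exact ⟨criticalPoints_eq_singleton he hpq h, isLocalMax_zero hpq.le h⟩

theorem three_point_phase {e : ℝ} (he : e ^ 2 = 1) (hm : β * lm / 2 < 1) (hM : 1 < β * lM / 2) :
    ∃ x : ℝ, IsPosSolution β lM x ∧
      criticalPoints (pairPotential (β * lm / 2) (β * lM / 2) e) =
        {(0, 0), (x, e * x), (-x, -(e * x))} ∧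
      (criticalPoints (pairPotential (β * lm / 2) (β * lM / 2) e)).ncard = 3 ∧
      IsInflectionPoint (pairPotential (β * lm / 2) (β * lM / 2) e) (0, 0) ∧
      IsLocalMax (pairPotential (β * lm / 2) (β * lM / 2) e) (x, e * x) ∧
      IsLocalMax (pairPotential (β * lm / 2) (β * lM / 2) e) (-x, -(e * x)) := by
  obtain ⟨w, hw, hqw⟩ := exists_mul_cosh_eq hM
  have hcrit := criticalPoints_eq_three he hm hw hqw
  have hmax := isLocalMax_of_major he (hm.trans hM).le hw hqw
  have hmax' := IsLocalMax.neg_of_even (pairPotential_neg _ _ _) hmax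
  rw [Prod.neg_mk] at hmax'
  refine ⟨tanh w, isPosSolution_tanh hw hqw, hcrit, ?_, isInflectionPoint_zero he hm hM, hmax,
    hmax'⟩
  rw [hcrit]
  exact ncard_three (tanh_pos hw)

theorem five_point_phase {w₀ : ℝ} (hβ : 0 < β) (hl : lm < lM)
    (hm : 1 < β * lm / 2) (hw₀ : 0 < w₀) (hR : lM = lm * sinhc (2 * w₀))
    (hM : β * lM / 2 < cosh w₀ ^ 2) :
    ∃ x y : ℝ, IsPosSolution β lM x ∧ IsPosSolution β lm y ∧
      criticalPoints (pairPotential (β * lm / 2) (β * lM / 2) (-1)) =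
        {(0, 0), (x, -x), (-x, x), (y, y), (-y, -y)} ∧
      (criticalPoints (pairPotential (β * lm / 2) (β * lM / 2) (-1))).ncard = 5 ∧
      IsLocalMin (pairPotential (β * lm / 2) (β * lM / 2) (-1)) (0, 0) ∧
      IsLocalMax (pairPotential (β * lm / 2) (β * lM / 2) (-1)) (x, -x) ∧
      IsLocalMax (pairPotential (β * lm / 2) (β * lM / 2) (-1)) (-x, x) ∧
      IsInflectionPoint (pairPotential (β * lm / 2) (β * lM / 2) (-1)) (y, y) ∧
      IsInflectionPoint (pairPotential (β * lm / 2) (β * lM / 2) (-1)) (-y, -y) := by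
  have he : (-1 : ℝ) ^ 2 = 1 := by norm_num
  have hpq : β * lm / 2 < β * lM / 2 := by nlinarith
  obtain ⟨w, hw, hqw⟩ := exists_mul_cosh_eq (hm.trans hpq)
  obtain ⟨w', hw', hpw⟩ := exists_mul_cosh_eq hm
  have hq : β * lM / 2 = β * lm / 2 * sinhc (2 * w₀) := by rw [hR]; ring
  -- The condition on β says w' < w₀, hence cosh² w' = p sinhc(2w') < p sinhc(2w₀) = q.
  have hlt : cosh w' ^ 2 < β * lM / 2 := by
    rw [hq] at hM ⊢
    have h := (mul_sinhc_two_mul_lt_iff hw' hpw hw₀).1 hM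
    rw [← mul_sinhc_two_mul_eq hw' hpw]
    exact mul_lt_mul_of_pos_left (strictMonoOn_sinhc (mem_Ici.2 (by linarith))
      (mem_Ici.2 (by linarith)) (by linarith)) (by linarith)
  have hcrit := criticalPoints_eq_five hw hqw hw' hpw (by linarith) hlt
  have hmax := isLocalMax_of_major he hpq.le hw hqw
  have hmax' := IsLocalMax.neg_of_even (pairPotential_neg _ _ _) hmax
  rw [Prod.neg_mk, neg_one_mul, neg_neg] at hmax'
  rw [neg_one_mul] at hmax
  have hinf := isInflectionPoint_minor hw' hpw hlt (by rw [hcrit]; simp)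
  refine ⟨tanh w, tanh w', isPosSolution_tanh hw hqw, isPosSolution_tanh hw' hpw, hcrit, ?_,
    isLocalMin_zero he hpq.le hw' hpw, hmax, hmax', hinf, by rw [hcrit]; simp, fun h => ?_,
    fun h => ?_⟩
  · rw [hcrit]
    exact ncard_five (tanh_pos hw) (tanh_pos hw')
  · exact hinf.2.1 (by simpa using IsLocalMax.neg_of_even (pairPotential_neg _ _ _) h)
  · exact hinf.2.2 (by simpa using IsLocalMin.neg_of_even (pairPotential_neg _ _ _) h)

theorem nine_point_phase {w₀ : ℝ} (hβ : 0 < β) (hl : lm < lM)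
    (hm : 1 < β * lm / 2) (hw₀ : 0 < w₀) (hR : lM = lm * sinhc (2 * w₀))
    (hM : cosh w₀ ^ 2 < β * lM / 2) :
    ∃ x y x₁ x₂ : ℝ, IsPosSolution β lM x ∧ IsPosSolution β lm y ∧ 0 < x₁ ∧ x₁ < x₂ ∧
      criticalPoints (pairPotential (β * lm / 2) (β * lM / 2) (-1)) =
        {(0, 0), (x, -x), (-x, x), (y, y), (-y, -y),
          (x₁, x₂), (-x₁, -x₂), (x₂, x₁), (-x₂, -x₁)} ∧
      (criticalPoints (pairPotential (β * lm / 2) (β * lM / 2) (-1))).ncard = 9 ∧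
      IsLocalMin (pairPotential (β * lm / 2) (β * lM / 2) (-1)) (0, 0) ∧
      IsLocalMax (pairPotential (β * lm / 2) (β * lM / 2) (-1)) (x, -x) ∧
      IsLocalMax (pairPotential (β * lm / 2) (β * lM / 2) (-1)) (-x, x) ∧
      IsLocalMax (pairPotential (β * lm / 2) (β * lM / 2) (-1)) (y, y) ∧
      IsLocalMax (pairPotential (β * lm / 2) (β * lM / 2) (-1)) (-y, -y) ∧
      ¬ IsLocalMax (pairPotential (β * lm / 2) (β * lM / 2) (-1)) (x₁, x₂) ∧
      ¬ IsLocalMax (pairPotential (β * lm / 2) (β * lM / 2) (-1)) (-x₁, -x₂) ∧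
      ¬ IsLocalMax (pairPotential (β * lm / 2) (β * lM / 2) (-1)) (x₂, x₁) ∧
      ¬ IsLocalMax (pairPotential (β * lm / 2) (β * lM / 2) (-1)) (-x₂, -x₁) := by
  have he : (-1 : ℝ) ^ 2 = 1 := by norm_num
  have hpq : β * lm / 2 < β * lM / 2 := by nlinarith
  obtain ⟨w, hw, hqw⟩ := exists_mul_cosh_eq (hm.trans hpq)
  obtain ⟨w', hw', hpw⟩ := exists_mul_cosh_eq hm
  have hq : β * lM / 2 = β * lm / 2 * sinhc (2 * w₀) := by rw [hR]; ring
  -- Above the threshold w₀ < w', and the comparison is reversed.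
  have hlt : β * lM / 2 < cosh w' ^ 2 := by
    rw [hq] at hM ⊢
    have h := (lt_mul_sinhc_two_mul_iff hw' hpw hw₀).1 hM
    rw [← mul_sinhc_two_mul_eq hw' hpw]
    exact mul_lt_mul_of_pos_left (strictMonoOn_sinhc (mem_Ici.2 (by linarith))
      (mem_Ici.2 (by linarith)) (by linarith)) (by linarith)
  obtain ⟨U, V, hU, hV, hUV⟩ := exists_hyperbolicSystem hpq hw' hpw hlt
  have hVU := hUV.lt_of_lt hU hV (by linarith) hpq
  have hcrit := criticalPoints_eq_nine hw hqw hw' hpw (by linarith) (by linarith) hU hV hUV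
  have hmax := isLocalMax_of_major he hpq.le hw hqw
  have hmax' := IsLocalMax.neg_of_even (pairPotential_neg _ _ _) hmax
  rw [Prod.neg_mk, neg_one_mul, neg_neg] at hmax'
  rw [neg_one_mul] at hmax
  have hmin := isLocalMax_of_minor hpq.le hpw hlt
  have hmin' := IsLocalMax.neg_of_even (pairPotential_neg _ _ _) hmin
  rw [Prod.neg_mk] at hmin'
  obtain ⟨v, hv⟩ := hUV.exists_hessianForm_pos hU hV
  have hnot := not_isLocalMax_of_hessianForm_pos he (tanh_half_mem_criticalPoints.2 hUV) v hv
  have hswap : ¬ IsLocalMax (pairPotential (β * lm / 2) (β * lM / 2) (-1))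
      (tanh ((U + V) / 2), tanh ((U - V) / 2)) :=
    fun h => hnot (IsLocalMax.swap_of_symm (z := (tanh ((U + V) / 2), tanh ((U - V) / 2)))
      (fun z => pairPotential_swap he z) h)
  have h1 : 0 < tanh ((U - V) / 2) := tanh_pos (by linarith)
  have h2 : tanh ((U - V) / 2) < tanh ((U + V) / 2) := tanh_strictMono (by linarith)
  have hnot' : ¬ IsLocalMax (pairPotential (β * lm / 2) (β * lM / 2) (-1))
      (-tanh ((U - V) / 2), -tanh ((U + V) / 2)) :=
    fun h => hnot (by simpa using IsLocalMax.neg_of_even (pairPotential_neg _ _ _) h)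
  have hswap' : ¬ IsLocalMax (pairPotential (β * lm / 2) (β * lM / 2) (-1))
      (-tanh ((U + V) / 2), -tanh ((U - V) / 2)) :=
    fun h => hswap (by simpa using IsLocalMax.neg_of_even (pairPotential_neg _ _ _) h)
  have hcard := ncard_nine (tanh_pos hw) (tanh_pos hw') h1 h2
  rw [← hcrit] at hcard
  refine ⟨tanh w, tanh w', tanh ((U - V) / 2), tanh ((U + V) / 2), isPosSolution_tanh hw hqw,
    isPosSolution_tanh hw' hpw, h1, h2, hcrit, hcard, isLocalMin_zero he hpq.le hw' hpw, hmax,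
    hmax', hmin, hmin', hnot, hnot', hswap, hswap'⟩

end Phases

end BipartiteMeanField

/-! ### The three sign regimes of the couplings -/

theorem proposition2 (α J11 J12 J22 h1 h2 lM lm : ℝ)
    (hα : α = 1 / 2) (hJ : J11 = J22) (hh1 : h1 = 0) (hh2 : h2 = 0)
    (hM : IsGreatest (BipartiteMeanField.eigenvalueSet J11 J12 J22) lM)
    (hm : IsLeast (BipartiteMeanField.eigenvalueSet J11 J12 J22) lm)
    (f : ℝ → ℝ × ℝ → ℝ)
    (hf : ∀ β, f β = BipartiteMeanField.pressureFunctional β α J11 J12 J22 h1 h2) :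
    -- first case
    (0 < J11 → J12 < 0 →
      lM = J11 - J12 ∧ lm = J11 + J12 ∧
      -- (a)
      (∀ β : ℝ, 0 < β → β ≤ 2 / lM →
        BipartiteMeanField.criticalPoints (f β) = {(0, 0)} ∧ IsLocalMax (f β) (0, 0)) ∧
      -- (b)
      (∀ β : ℝ, (lm < 0 ∧ 2 / lM < β) ∨ (0 < lm ∧ 2 / lM < β ∧ β < 2 / lm) →
        ∃ x : ℝ, BipartiteMeanField.IsPosSolution β lM x ∧
          BipartiteMeanField.criticalPoints (f β) = {(0, 0), (x, -x), (-x, x)} ∧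
          (BipartiteMeanField.criticalPoints (f β)).ncard = 3 ∧
          BipartiteMeanField.IsInflectionPoint (f β) (0, 0) ∧
          IsLocalMax (f β) (x, -x) ∧ IsLocalMax (f β) (-x, x)) ∧
      (0 < lm →
        (∃! s : ℝ, BipartiteMeanField.IsThreshold lM lm s) ∧
        ∀ s : ℝ, BipartiteMeanField.IsThreshold lM lm s →
          2 / lm < 2 / (s * lM) ∧
          -- (c)
          (∀ β : ℝ, 2 / lm < β → β < 2 / (s * lM) →
            ∃ x y : ℝ, BipartiteMeanField.IsPosSolution β lM x ∧
              BipartiteMeanField.IsPosSolution β lm y ∧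
              BipartiteMeanField.criticalPoints (f β) =
                {(0, 0), (x, -x), (-x, x), (y, y), (-y, -y)} ∧
              (BipartiteMeanField.criticalPoints (f β)).ncard = 5 ∧
              IsLocalMin (f β) (0, 0) ∧
              IsLocalMax (f β) (x, -x) ∧ IsLocalMax (f β) (-x, x) ∧
              BipartiteMeanField.IsInflectionPoint (f β) (y, y) ∧
              BipartiteMeanField.IsInflectionPoint (f β) (-y, -y)) ∧
          -- (d)
          (∀ β : ℝ, 2 / (s * lM) < β →
            ∃ x y x₁ x₂ : ℝ, BipartiteMeanField.IsPosSolution β lM x ∧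
              BipartiteMeanField.IsPosSolution β lm y ∧ 0 < x₁ ∧ x₁ < x₂ ∧
              BipartiteMeanField.criticalPoints (f β) =
                {(0, 0), (x, -x), (-x, x), (y, y), (-y, -y),
                  (x₁, x₂), (-x₁, -x₂), (x₂, x₁), (-x₂, -x₁)} ∧
              (BipartiteMeanField.criticalPoints (f β)).ncard = 9 ∧
              IsLocalMin (f β) (0, 0) ∧
              IsLocalMax (f β) (x, -x) ∧ IsLocalMax (f β) (-x, x) ∧
              IsLocalMax (f β) (y, y) ∧ IsLocalMax (f β) (-y, -y) ∧
              ¬ IsLocalMax (f β) (x₁, x₂) ∧ ¬ IsLocalMax (f β) (-x₁, -x₂) ∧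
              ¬ IsLocalMax (f β) (x₂, x₁) ∧ ¬ IsLocalMax (f β) (-x₂, -x₁)))) ∧
    -- second case
    (J11 < 0 → |J11| < J12 →
      lM = J11 + J12 ∧ 0 < lM ∧ lm = J11 - J12 ∧ lm < 0 ∧
      -- (a)
      (∀ β : ℝ, 0 < β → β < 2 / lM →
        BipartiteMeanField.criticalPoints (f β) = {(0, 0)} ∧ IsLocalMax (f β) (0, 0)) ∧
      -- (b)
      (∀ β : ℝ, 2 / lM < β →
        ∃ x : ℝ, BipartiteMeanField.IsPosSolution β lM x ∧
          BipartiteMeanField.criticalPoints (f β) = {(0, 0), (x, x), (-x, -x)} ∧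
          (BipartiteMeanField.criticalPoints (f β)).ncard = 3 ∧
          BipartiteMeanField.IsInflectionPoint (f β) (0, 0) ∧
          IsLocalMax (f β) (x, x) ∧ IsLocalMax (f β) (-x, -x))) ∧
    -- third case
    (J11 < 0 → 0 < J12 → J12 < |J11| →
      lM = J11 + J12 ∧ lM < 0 ∧ lm = J11 - J12 ∧ lm < 0 ∧
      ∀ β : ℝ, 0 < β →
        BipartiteMeanField.criticalPoints (f β) = {(0, 0)} ∧ IsLocalMax (f β) (0, 0)) := by
  subst hα hJ hh1 hh2
  rw [BipartiteMeanField.eigenvalueSet_eq] at hM hm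
  have hpos : ∀ {β l : ℝ}, 0 < l → (1 < β * l / 2 ↔ 2 / l < β) := by
    intro β l hl
    rw [lt_div_iff₀ two_pos, div_lt_iff₀ hl, one_mul]
  have hneg : ∀ {β l : ℝ}, 0 < l → (β * l / 2 < 1 ↔ β < 2 / l) := by
    intro β l hl
    rw [div_lt_iff₀ two_pos, lt_div_iff₀ hl, one_mul]
  refine ⟨fun ha hb => ?_, fun ha hb => ?_, fun ha hb hab => ?_⟩
  · have hlt : J11 + J12 < J11 - J12 := by linarith
    rw [BipartiteMeanField.isGreatest_pair_iff hlt] at hM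
    rw [BipartiteMeanField.isLeast_pair_iff hlt] at hm
    -- Since J12 < 0, the larger eigenvalue belongs to (1, −1).
    have hf' : ∀ β, f β = BipartiteMeanField.pairPotential (β * lm / 2) (β * lM / 2) (-1) := by
      intro β
      rw [hf, BipartiteMeanField.pressureFunctional_eq β J11 J12 (e := -1) (by norm_num), hM, hm]
      ring_nf
    have hM0 : 0 < lM := by linarith
    have hmM : lm < lM := by linarith
    refine ⟨hM, hm, fun β hβ hβM => ?_, fun β hβ => ?_, fun hm0 => ⟨?_, fun s hs => ?_⟩⟩
    · rw [hf']
      exact BipartiteMeanField.unique_phase (by norm_num) hβ hmM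
        (not_lt.1 fun h => hβM.not_gt ((hpos hM0).1 h))
    · have hβM : 2 / lM < β := by
        rcases hβ with h | h
        · exact h.2
        · exact h.2.1
      have hβ0 : 0 < β := (by positivity : 0 < 2 / lM).trans hβM
      have hβm : β * lm / 2 < 1 := by
        rcases hβ with h | h
        · nlinarith [mul_neg_of_pos_of_neg hβ0 h.1]
        · exact (hneg h.1).2 h.2.2
      rw [hf']
      simpa using BipartiteMeanField.three_point_phase (e := -1) (by norm_num) hβm
        ((hpos hM0).2 hβM)
    · exact BipartiteMeanField.existsUnique_isThreshold hm0 hmM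
    · obtain ⟨w, hw, rfl, h⟩ := BipartiteMeanField.isThreshold_iff.1 hs
      have hsc := BipartiteMeanField.sinhc_pos (by linarith : 0 ≤ 2 * w)
      have hR : lM = lm * BipartiteMeanField.sinhc (2 * w) := by
        rw [div_eq_div_iff hsc.ne' hM0.ne'] at h
        linarith
      have hc := Real.cosh_pos w
      have hthr : 2 / (1 / Real.cosh w ^ 2 * lM) = 2 * Real.cosh w ^ 2 / lM := by
        field_simp
      -- As λ_M/λ_m = sinhc(2w), this says sinhc(2w) < cosh² w, that is, tanh w < w.
      have hlow : 2 / lm < 2 * Real.cosh w ^ 2 / lM := by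
        rw [div_lt_div_iff₀ hm0 hM0, hR]
        have h1 := BipartiteMeanField.sinh_lt_mul_cosh hw
        have h2 : BipartiteMeanField.sinhc (2 * w) < Real.cosh w ^ 2 := by
          rw [BipartiteMeanField.sinhc_two_mul hw.ne', div_lt_iff₀ hw]
          nlinarith
        nlinarith [mul_lt_mul_of_pos_left h2 hm0]
      rw [hthr]
      refine ⟨hlow, fun β hβ1 hβ2 => ?_, fun β hβ => ?_⟩
      · have hβ0 : 0 < β := (by positivity : 0 < 2 / lm).trans hβ1
        rw [hf']
        refine BipartiteMeanField.five_point_phase hβ0 hmM ((hpos hm0).2 hβ1) hw hR ?_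
        rw [lt_div_iff₀ hM0] at hβ2
        linarith
      · have hβ1 := hlow.trans hβ
        have hβ0 : 0 < β := (by positivity : 0 < 2 / lm).trans hβ1
        rw [hf']
        refine BipartiteMeanField.nine_point_phase hβ0 hmM ((hpos hm0).2 hβ1) hw hR ?_
        rw [div_lt_iff₀ hM0] at hβ
        linarith
  · rw [abs_of_neg ha] at hb
    have hlt : J11 - J12 < J11 + J12 := by linarith
    rw [Set.pair_comm, BipartiteMeanField.isGreatest_pair_iff hlt] at hM
    rw [Set.pair_comm, BipartiteMeanField.isLeast_pair_iff hlt] at hm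
    have hf' : ∀ β, f β = BipartiteMeanField.pairPotential (β * lm / 2) (β * lM / 2) 1 := by
      intro β
      rw [hf, BipartiteMeanField.pressureFunctional_eq β J11 J12 (e := 1) (by norm_num), hM, hm,
        one_mul]
    have hM0 : 0 < lM := by linarith
    have hm0 : lm < 0 := by linarith
    refine ⟨hM, hM0, hm, hm0, fun β hβ hβM => ?_, fun β hβM => ?_⟩
    · rw [hf']
      exact BipartiteMeanField.unique_phase (by norm_num) hβ (by linarith) ((hneg hM0).2 hβM).le
    · have hβ0 : 0 < β := (by positivity : 0 < 2 / lM).trans hβM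
      have hβm : β * lm / 2 < 1 := by nlinarith [mul_neg_of_pos_of_neg hβ0 hm0]
      rw [hf']
      simpa using BipartiteMeanField.three_point_phase (e := 1) (by norm_num) hβm
        ((hpos hM0).2 hβM)
  · rw [abs_of_neg ha] at hab
    have hlt : J11 - J12 < J11 + J12 := by linarith
    rw [Set.pair_comm, BipartiteMeanField.isGreatest_pair_iff hlt] at hM
    rw [Set.pair_comm, BipartiteMeanField.isLeast_pair_iff hlt] at hm
    have hM0 : lM < 0 := by linarith
    refine ⟨hM, hM0, hm, by linarith, fun β hβ => ?_⟩
    rw [hf, BipartiteMeanField.pressureFunctional_eq β J11 J12 (e := 1) (by norm_num), one_mul,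
      ← hM, ← hm]
    -- Here βλ_M/2 < 0, so the condition q ≤ 1 holds at every β > 0.
    exact BipartiteMeanField.unique_phase (by norm_num) hβ (by linarith)
      (by nlinarith [mul_neg_of_pos_of_neg hβ hM0])
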